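/- Let $\mathcal E$ be a Barr-exact category, let $\mathbb A,\mathbb B,\mathbb C$ be internal groupoids in $\mathcal E$, with domain and codomain maps written $d,c$, and let $S$ be an internal distributor between $\mathbb A$ and $\mathbb B$ and $T$ one between $\mathbb B$ and $\mathbb C$. That is, $S$ is a span $A_0 \xleftarrow{L} S_0 \xrightarrow{R} B_0$ with a left action $\lambda_S\colon A_1\times_{A_0}S_0\to S_0$ (defined on pairs $(\alpha,s)$ with $d\alpha=Ls$) and a right action $\rho_S\colon S_0\times_{B_0}B_1\to S_0$ (defined on pairs $(s,\beta)$ with $Rs=c\beta$) which are associative, unital and compatible; similarly for $T$. Write $\mathbb S$ for the internal groupoid with object of objects $S_0$ and object of arrows $S_1$ the pullback of $\lambda_S$ and $\rho_S$ (so that an arrow $s\to s'$ is a pair $(\alpha,\beta)$ with $\alpha\cdot s=s'\cdot\beta$), with its projection functors $L\colon\mathbb S\to\mathbb A$ and $R\colon\mathbb S\to\mathbb B$; similarly for $\mathbb T$. Let $T\diamond S=\mathbb S\times_{\mathbb B}\mathbb T$ be the composite span (the levelwise pullback), with projections $\bar L\colon T\diamond S\to \mathbb S$ and $\bar R\colon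 T\diamond S\to\mathbb T$. Let $T\otimes S$ be the composite distributor: its object $(T\otimes S)_0$ is the coequalizer $Q_0\colon S_0\times_{B_0}T_0\to (T\otimes S)_0$ of $\rho_S\times \mathrm{id}$ and $\mathrm{id}\times\lambda_T\colon S_0\times_{B_0}B_1\times_{B_0}T_0\rightrightarrows S_0\times_{B_0}T_0$, with the legs to $A_0$ and $C_0$ and the actions of $\mathbb A$ and $\mathbb C$ induced from those of $S$ and $T$. Write $\mathbb{P}$ for the internal groupoid associated with the distributor $T\otimes S$ in the same way, and $P\colon\mathbb{P}\to\mathbb A\times\mathbb C$ for the functor given by its two projections. An internal functor $F\colon \mathbb X\to\mathbb Y$ is a discrete fibration if the square $c\cdot F_1=F_0\cdot c$ is a pullback, and final if it is left orthogonal to all discrete fibrations between internal groupoids in $\mathcal E$. It is internally full if the canonical comparison from $X_1$ to the joint pullback of $d,c\colon Y_1\rightrightarrows Y_0$ along $F_0$ is a regular epimorphism, and internally essentially surjective if $\Pi_0(F)$ is an isomorphism, where $\Pi_0(\mathbb X)$ is the coequalizer of $d,c\colon X_1\rightrightarrows X_0$. Then the factorization of $\langle L\bar L,R\bar R\rangle\colon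 T\diamond S\to\mathbb A\times\mathbb C$ through $P$ is its comprehensive factorization. More precisely: 1. There is exactly one internal functor $Q=(Q_0,Q_1)\colon T\diamond S\to\mathbb{P}$ whose component on objects is the coequalizer $Q_0$ and for which $P\cdot Q=\langle L\bar L,R\bar R\rangle$. 2. $Q$ is internally full and internally essentially surjective, and it is final; $P$ is a discrete fibration. 3. If $\langle L\bar L,R\bar R\rangle=G\cdot F$ with $F\colon T\diamond S\to\mathbb Z$ final and $G\colon\mathbb Z\to\mathbb A\times\mathbb C$ a discrete fibration, where $\mathbb Z$ is an internal groupoid in $\mathcal E$, then there is exactly one isomorphism $i\colon\mathbb Z\to\mathbb{P}$ with $i\cdot F=Q$ and $P\cdot i=G$. -/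

import Mathlib

open CategoryTheory Limits

universe v u

namespace InternalGpd

/-- A Barr-exact category: a regular category (finite limits, coequalizers of kernel pairs,
pullback-stable regular epimorphisms) in which every internal equivalence relation is effective. -/
class BarrExact (E : Type u) [Category.{v} E] : Prop extends Regular E where
  effective : ∀ {R X : E} (p₁ p₂ : R ⟶ X), IsEquivalenceRelation p₁ p₂ →
    IsEffectiveEquivalenceRelation p₁ p₂

/-! ### Internal groupoids and internal functors -/

section Groupoids

attribute [local simp] pullback.lift_fst pullback.lift_snd pullback.lift_fst_assoc
  pullback.lift_snd_assoc prod.lift_fst prod.lift_snd prod.lift_fst_assoc prod.lift_snd_assoc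

/-- An internal groupoid. `m` is composition in diagrammatic order, defined on the object of
composable pairs `(f, g)` with `c f = d g`; `τ` is inversion. Associativity is stated on
generalized elements. -/
structure IntGpd (E : Type u) [Category.{v} E] [HasFiniteLimits E] where
  C₀ : E
  C₁ : E
  d : C₁ ⟶ C₀
  c : C₁ ⟶ C₀
  e : C₀ ⟶ C₁
  m : pullback c d ⟶ C₁
  τ : C₁ ⟶ C₁
  e_d : e ≫ d = 𝟙 C₀
  e_c : e ≫ c = 𝟙 C₀
  m_d : m ≫ d = pullback.fst c d ≫ d
  m_c : m ≫ c = pullback.snd c d ≫ c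
  id_m : pullback.lift (d ≫ e) (𝟙 C₁) (by rw [Category.assoc, e_c, Category.comp_id,
    Category.id_comp]) ≫ m = 𝟙 C₁
  m_id : pullback.lift (𝟙 C₁) (c ≫ e) (by rw [Category.assoc, e_d, Category.comp_id,
    Category.id_comp]) ≫ m = 𝟙 C₁
  m_assoc : ∀ {X : E} (f g h : X ⟶ C₁) (hfg : f ≫ c = g ≫ d) (hgh : g ≫ c = h ≫ d),
    pullback.lift (pullback.lift f g hfg ≫ m) h
      (by rw [Category.assoc, m_c, pullback.lift_snd_assoc, hgh]) ≫ m =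
    pullback.lift f (pullback.lift g h hgh ≫ m)
      (by rw [Category.assoc, m_d, pullback.lift_fst_assoc, hfg]) ≫ m
  τ_d : τ ≫ d = c
  τ_c : τ ≫ c = d
  m_τ : pullback.lift (𝟙 C₁) τ (by rw [τ_d, Category.id_comp]) ≫ m = d ≫ e
  τ_m : pullback.lift τ (𝟙 C₁) (by rw [τ_c, Category.id_comp]) ≫ m = c ≫ e

variable {E : Type u} [Category.{v} E] [HasFiniteLimits E]

namespace IntGpd

variable (G : IntGpd E) {X Y : E}

/-- Composition of composable generalized elements of the object of arrows. -/
noncomputable def comp (f g : X ⟶ G.C₁) (h : f ≫ G.c = g ≫ G.d) : X ⟶ G.C₁ :=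
  pullback.lift f g h ≫ G.m

variable {G}

lemma comp_d (f g : X ⟶ G.C₁) (h : f ≫ G.c = g ≫ G.d) : G.comp f g h ≫ G.d = f ≫ G.d := by
  simp [comp, G.m_d]

lemma comp_c (f g : X ⟶ G.C₁) (h : f ≫ G.c = g ≫ G.d) : G.comp f g h ≫ G.c = g ≫ G.c := by
  simp [comp, G.m_c]

lemma comp_congr {f f' g g' : X ⟶ G.C₁} (h : f ≫ G.c = g ≫ G.d) (hf : f = f') (hg : g = g') :
    G.comp f g h = G.comp f' g' (by rw [← hf, ← hg, h]) := by
  subst hf hg; rfl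

lemma precomp (k : Y ⟶ X) (f g : X ⟶ G.C₁) (h : f ≫ G.c = g ≫ G.d) :
    k ≫ G.comp f g h = G.comp (k ≫ f) (k ≫ g) (by simp [h]) := by
  rw [comp, comp, ← Category.assoc]
  congr 1
  ext <;> simp

lemma id_comp (f : X ⟶ G.C₁) (x : X ⟶ G.C₀) (hx : f ≫ G.d = x) :
    G.comp (x ≫ G.e) f (by simp [G.e_c, hx]) = f := by
  subst hx
  refine Eq.trans ?_ ((congrArg (fun t => f ≫ t) G.id_m).trans (Category.comp_id f))
  refine Eq.trans ?_ (Category.assoc _ _ _)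
  rw [comp]
  congr 1
  ext <;> simp

lemma comp_id (f : X ⟶ G.C₁) (x : X ⟶ G.C₀) (hx : f ≫ G.c = x) :
    G.comp f (x ≫ G.e) (by simp [G.e_d, hx]) = f := by
  subst hx
  refine Eq.trans ?_ ((congrArg (fun t => f ≫ t) G.m_id).trans (Category.comp_id f))
  refine Eq.trans ?_ (Category.assoc _ _ _)
  rw [comp]
  congr 1
  ext <;> simp

lemma assoc (f g h : X ⟶ G.C₁) (hfg : f ≫ G.c = g ≫ G.d) (hgh : g ≫ G.c = h ≫ G.d) :
    G.comp (G.comp f g hfg) h (by rw [comp_c, hgh]) =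
      G.comp f (G.comp g h hgh) (by rw [comp_d, hfg]) :=
  G.m_assoc f g h hfg hgh

lemma comp_inv (f : X ⟶ G.C₁) :
    G.comp f (f ≫ G.τ) (by simp [G.τ_d]) = f ≫ G.d ≫ G.e := by
  refine Eq.trans ?_ (congrArg (fun t => f ≫ t) G.m_τ)
  refine Eq.trans ?_ (Category.assoc _ _ _)
  rw [comp]
  congr 1
  ext <;> simp

lemma inv_comp (f : X ⟶ G.C₁) :
    G.comp (f ≫ G.τ) f (by simp [G.τ_c]) = f ≫ G.c ≫ G.e := by
  refine Eq.trans ?_ (congrArg (fun t => f ≫ t) G.τ_m)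
  refine Eq.trans ?_ (Category.assoc _ _ _)
  rw [comp]
  congr 1
  ext <;> simp

end IntGpd

/-- An internal functor; preservation of composition is stated on the object of composable pairs. -/
@[ext]
structure IntFunctor (G H : IntGpd E) where
  F₀ : G.C₀ ⟶ H.C₀
  F₁ : G.C₁ ⟶ H.C₁
  map_d : F₁ ≫ H.d = G.d ≫ F₀
  map_c : F₁ ≫ H.c = G.c ≫ F₀
  map_e : G.e ≫ F₁ = F₀ ≫ H.e
  map_m : G.m ≫ F₁ = H.comp (pullback.fst G.c G.d ≫ F₁) (pullback.snd G.c G.d ≫ F₁)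
    (by rw [Category.assoc, Category.assoc, map_c, map_d, pullback.condition_assoc])

lemma IntFunctor.map_comp {G H : IntGpd E} (F : IntFunctor G H) {X : E} (f g : X ⟶ G.C₁)
    (h : f ≫ G.c = g ≫ G.d) :
    G.comp f g h ≫ F.F₁ = H.comp (f ≫ F.F₁) (g ≫ F.F₁)
      (by rw [Category.assoc, Category.assoc, F.map_c, F.map_d, reassoc_of% h]) := by
  rw [IntGpd.comp, Category.assoc, F.map_m, IntGpd.precomp]
  apply IntGpd.comp_congr <;> simp

lemma IntFunctor.map_τ {G H : IntGpd E} (F : IntFunctor G H) : G.τ ≫ F.F₁ = F.F₁ ≫ H.τ := by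
  have h₁ : (G.τ ≫ F.F₁) ≫ H.c = F.F₁ ≫ H.d := by
    simp [F.map_c, F.map_d, reassoc_of% G.τ_c]
  have h₂ : F.F₁ ≫ H.c = (F.F₁ ≫ H.τ) ≫ H.d := by simp [H.τ_d]
  have h₃ : H.comp (G.τ ≫ F.F₁) F.F₁ h₁ = G.c ≫ F.F₀ ≫ H.e := by
    rw [← F.map_e, ← Category.assoc G.c, ← G.τ_m]
    refine Eq.trans ?_ (F.map_comp G.τ (𝟙 _) (by simp [G.τ_c])).symm
    apply IntGpd.comp_congr <;> simp
  have h₄ := IntGpd.assoc (G.τ ≫ F.F₁) F.F₁ (F.F₁ ≫ H.τ) h₁ h₂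
  rw [IntGpd.comp_congr _ rfl (IntGpd.comp_inv F.F₁), IntGpd.comp_congr _ h₃ rfl] at h₄
  have h₅ := IntGpd.comp_id (G.τ ≫ F.F₁) (F.F₁ ≫ H.d) h₁
  have h₆ := IntGpd.id_comp (F.F₁ ≫ H.τ) (G.c ≫ F.F₀) (by simp [H.τ_d, F.map_c])
  simp only [Category.assoc] at h₄ h₅ h₆
  exact h₅.symm.trans (h₄.symm.trans h₆)

/-- The category of internal groupoids and internal functors. -/
instance : Category (IntGpd E) where
  Hom G H := IntFunctor G H
  id G :=
    { F₀ := 𝟙 _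
      F₁ := 𝟙 _
      map_d := by simp
      map_c := by simp
      map_e := by simp
      map_m := by
        rw [IntGpd.comp, Category.comp_id]
        refine (Category.id_comp G.m).symm.trans ?_
        congr 1
        ext <;> simp }
  comp F K :=
    { F₀ := F.F₀ ≫ K.F₀
      F₁ := F.F₁ ≫ K.F₁
      map_d := by simp [K.map_d, reassoc_of% F.map_d]
      map_c := by simp [K.map_c, reassoc_of% F.map_c]
      map_e := by simp [← K.map_e, reassoc_of% F.map_e]
      map_m := by
        rw [← Category.assoc, F.map_m, IntFunctor.map_comp]
        apply IntGpd.comp_congr <;> simp }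
  id_comp F := by apply IntFunctor.ext <;> apply Category.id_comp
  comp_id F := by apply IntFunctor.ext <;> apply Category.comp_id
  assoc F G H := by apply IntFunctor.ext <;> apply Category.assoc

@[ext]
lemma IntFunctor.hom_ext {G H : IntGpd E} {F K : G ⟶ H} (h₀ : F.F₀ = K.F₀) (h₁ : F.F₁ = K.F₁) :
    F = K :=
  IntFunctor.ext h₀ h₁

@[simp]
lemma IntFunctor.comp_F₀ {G H K : IntGpd E} (F : G ⟶ H) (F' : H ⟶ K) :
    (F ≫ F').F₀ = F.F₀ ≫ F'.F₀ := rfl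

@[simp]
lemma IntFunctor.comp_F₁ {G H K : IntGpd E} (F : G ⟶ H) (F' : H ⟶ K) :
    (F ≫ F').F₁ = F.F₁ ≫ F'.F₁ := rfl

/-- The product of two internal groupoids, computed levelwise. -/
noncomputable def IntGpd.prod (G H : IntGpd E) : IntGpd E where
  C₀ := G.C₀ ⨯ H.C₀
  C₁ := G.C₁ ⨯ H.C₁
  d := prod.map G.d H.d
  c := prod.map G.c H.c
  e := prod.map G.e H.e
  τ := prod.map G.τ H.τ
  m := prod.lift
    (G.comp (pullback.fst _ _ ≫ prod.fst) (pullback.snd _ _ ≫ prod.fst) (by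
      have := congrArg (fun t => t ≫ prod.fst)
        (pullback.condition (f := prod.map G.c H.c) (g := prod.map G.d H.d))
      simpa using this))
    (H.comp (pullback.fst _ _ ≫ prod.snd) (pullback.snd _ _ ≫ prod.snd) (by
      have := congrArg (fun t => t ≫ prod.snd)
        (pullback.condition (f := prod.map G.c H.c) (g := prod.map G.d H.d))
      simpa using this))
  e_d := by simp [G.e_d, H.e_d]
  e_c := by simp [G.e_c, H.e_c]
  m_d := by ext <;> simp [IntGpd.comp_d]
  m_c := by ext <;> simp [IntGpd.comp_c]
  id_m := by
    ext
    · simp only [Category.assoc, prod.lift_fst, IntGpd.precomp, Category.id_comp]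
      refine (IntGpd.comp_congr _ ?_ ?_).trans (IntGpd.id_comp _ _ rfl) <;> simp
    · simp only [Category.assoc, prod.lift_snd, IntGpd.precomp, Category.id_comp]
      refine (IntGpd.comp_congr _ ?_ ?_).trans (IntGpd.id_comp _ _ rfl) <;> simp
  m_id := by
    ext
    · simp only [Category.assoc, prod.lift_fst, IntGpd.precomp, Category.id_comp]
      refine (IntGpd.comp_congr _ ?_ ?_).trans (IntGpd.comp_id _ _ rfl) <;> simp
    · simp only [Category.assoc, prod.lift_snd, IntGpd.precomp, Category.id_comp]
      refine (IntGpd.comp_congr _ ?_ ?_).trans (IntGpd.comp_id _ _ rfl) <;> simp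
  m_assoc f g h hfg hgh := by
    have a₁ := congrArg (fun t => t ≫ prod.fst) hfg
    have a₂ := congrArg (fun t => t ≫ prod.fst) hgh
    have b₁ := congrArg (fun t => t ≫ prod.snd) hfg
    have b₂ := congrArg (fun t => t ≫ prod.snd) hgh
    ext
    · simp only [Category.assoc, prod.lift_fst, IntGpd.precomp, pullback.lift_fst_assoc,
        pullback.lift_snd_assoc]
      exact IntGpd.assoc _ _ _ (by simpa using a₁) (by simpa using a₂)
    · simp only [Category.assoc, prod.lift_snd, IntGpd.precomp, pullback.lift_fst_assoc,
        pullback.lift_snd_assoc]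
      exact IntGpd.assoc _ _ _ (by simpa using b₁) (by simpa using b₂)
  τ_d := by simp [G.τ_d, H.τ_d]
  τ_c := by simp [G.τ_c, H.τ_c]
  m_τ := by
    ext
    · simp only [Category.assoc, prod.lift_fst, IntGpd.precomp]
      refine (IntGpd.comp_congr _ ?_ ?_).trans ((IntGpd.comp_inv prod.fst).trans ?_) <;> simp
    · simp only [Category.assoc, prod.lift_snd, IntGpd.precomp]
      refine (IntGpd.comp_congr _ ?_ ?_).trans ((IntGpd.comp_inv prod.snd).trans ?_) <;> simp
  τ_m := by
    ext
    · simp only [Category.assoc, prod.lift_fst, IntGpd.precomp]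
      refine (IntGpd.comp_congr _ ?_ ?_).trans ((IntGpd.inv_comp prod.fst).trans ?_) <;> simp
    · simp only [Category.assoc, prod.lift_snd, IntGpd.precomp]
      refine (IntGpd.comp_congr _ ?_ ?_).trans ((IntGpd.inv_comp prod.snd).trans ?_) <;> simp

/-- The functor `⟨F, K⟩` into a product of internal groupoids. -/
noncomputable def IntGpd.pair {G H Z : IntGpd E} (F : Z ⟶ G) (K : Z ⟶ H) : Z ⟶ G.prod H where
  F₀ := prod.lift F.F₀ K.F₀
  F₁ := prod.lift F.F₁ K.F₁
  map_d := by dsimp [IntGpd.prod]; ext <;> simp [F.map_d, K.map_d]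
  map_c := by dsimp [IntGpd.prod]; ext <;> simp [F.map_c, K.map_c]
  map_e := by dsimp [IntGpd.prod]; ext <;> simp [F.map_e, K.map_e]
  map_m := by
    dsimp only [IntGpd.prod, IntGpd.comp]
    ext
    · simp only [Category.assoc, prod.lift_fst, F.map_m]
      refine Eq.trans ?_ (IntGpd.precomp _ _ _ _).symm
      apply IntGpd.comp_congr <;> simp
    · simp only [Category.assoc, prod.lift_snd, K.map_m]
      refine Eq.trans ?_ (IntGpd.precomp _ _ _ _).symm
      apply IntGpd.comp_congr <;> simp

lemma IntGpd.pb_aux₁ {G H K : IntGpd E} (F : G ⟶ K) (F' : H ⟶ K) {X : E}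
    {f g : X ⟶ pullback F.F₁ F'.F₁} {a b : pullback F.F₁ F'.F₁ ⟶ H.C₀}
    {h₁ : (pullback.fst F.F₁ F'.F₁ ≫ G.c) ≫ F.F₀ = a ≫ F'.F₀}
    {h₂ : (pullback.fst F.F₁ F'.F₁ ≫ G.d) ≫ F.F₀ = b ≫ F'.F₀}
    (h : f ≫ pullback.lift (pullback.fst F.F₁ F'.F₁ ≫ G.c) a h₁ =
      g ≫ pullback.lift (pullback.fst F.F₁ F'.F₁ ≫ G.d) b h₂) :
    (f ≫ pullback.fst F.F₁ F'.F₁) ≫ G.c = (g ≫ pullback.fst F.F₁ F'.F₁) ≫ G.d := by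
  have := congrArg (fun t => t ≫ pullback.fst F.F₀ F'.F₀) h
  simpa using this

lemma IntGpd.pb_aux₂ {G H K : IntGpd E} (F : G ⟶ K) (F' : H ⟶ K) {X : E}
    {f g : X ⟶ pullback F.F₁ F'.F₁} {a b : pullback F.F₁ F'.F₁ ⟶ G.C₀}
    {h₁ : a ≫ F.F₀ = (pullback.snd F.F₁ F'.F₁ ≫ H.c) ≫ F'.F₀}
    {h₂ : b ≫ F.F₀ = (pullback.snd F.F₁ F'.F₁ ≫ H.d) ≫ F'.F₀}
    (h : f ≫ pullback.lift a (pullback.snd F.F₁ F'.F₁ ≫ H.c) h₁ =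
      g ≫ pullback.lift b (pullback.snd F.F₁ F'.F₁ ≫ H.d) h₂) :
    (f ≫ pullback.snd F.F₁ F'.F₁) ≫ H.c = (g ≫ pullback.snd F.F₁ F'.F₁) ≫ H.d := by
  have := congrArg (fun t => t ≫ pullback.snd F.F₀ F'.F₀) h
  simpa using this

/-- The pullback of internal groupoids along two internal functors, computed levelwise. -/
noncomputable def IntGpd.pb {G H K : IntGpd E} (F : G ⟶ K) (F' : H ⟶ K) : IntGpd E where
  C₀ := pullback F.F₀ F'.F₀
  C₁ := pullback F.F₁ F'.F₁
  d := pullback.lift (pullback.fst _ _ ≫ G.d) (pullback.snd _ _ ≫ H.d) (by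
    simp only [Category.assoc, ← F.map_d, ← F'.map_d, pullback.condition_assoc])
  c := pullback.lift (pullback.fst _ _ ≫ G.c) (pullback.snd _ _ ≫ H.c) (by
    simp only [Category.assoc, ← F.map_c, ← F'.map_c, pullback.condition_assoc])
  e := pullback.lift (pullback.fst _ _ ≫ G.e) (pullback.snd _ _ ≫ H.e) (by
    simp only [Category.assoc, F.map_e, F'.map_e, pullback.condition_assoc])
  τ := pullback.lift (pullback.fst _ _ ≫ G.τ) (pullback.snd _ _ ≫ H.τ) (by
    simp only [Category.assoc, F.map_τ, F'.map_τ, pullback.condition_assoc])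
  m := pullback.lift
    (G.comp (pullback.fst _ _ ≫ pullback.fst _ _) (pullback.snd _ _ ≫ pullback.fst _ _)
      (IntGpd.pb_aux₁ F F' (pullback.condition)))
    (H.comp (pullback.fst _ _ ≫ pullback.snd _ _) (pullback.snd _ _ ≫ pullback.snd _ _)
      (IntGpd.pb_aux₂ F F' (pullback.condition)))
    (by
      rw [F.map_comp, F'.map_comp]
      apply IntGpd.comp_congr <;> simp only [Category.assoc, pullback.condition])
  e_d := by ext <;> simp [G.e_d, H.e_d]
  e_c := by ext <;> simp [G.e_c, H.e_c]
  m_d := by ext <;> simp [IntGpd.comp_d]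
  m_c := by ext <;> simp [IntGpd.comp_c]
  id_m := by
    ext
    · simp only [Category.assoc, pullback.lift_fst, IntGpd.precomp, Category.id_comp]
      refine (IntGpd.comp_congr _ ?_ ?_).trans (IntGpd.id_comp _ _ rfl) <;> simp
    · simp only [Category.assoc, pullback.lift_snd, IntGpd.precomp, Category.id_comp]
      refine (IntGpd.comp_congr _ ?_ ?_).trans (IntGpd.id_comp _ _ rfl) <;> simp
  m_id := by
    ext
    · simp only [Category.assoc, pullback.lift_fst, IntGpd.precomp, Category.id_comp]
      refine (IntGpd.comp_congr _ ?_ ?_).trans (IntGpd.comp_id _ _ rfl) <;> simp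
    · simp only [Category.assoc, pullback.lift_snd, IntGpd.precomp, Category.id_comp]
      refine (IntGpd.comp_congr _ ?_ ?_).trans (IntGpd.comp_id _ _ rfl) <;> simp
  m_assoc f g h hfg hgh := by
    ext
    · simp only [Category.assoc, pullback.lift_fst, IntGpd.precomp, pullback.lift_fst_assoc,
        pullback.lift_snd_assoc]
      exact IntGpd.assoc _ _ _ (IntGpd.pb_aux₁ F F' hfg) (IntGpd.pb_aux₁ F F' hgh)
    · simp only [Category.assoc, pullback.lift_snd, IntGpd.precomp, pullback.lift_fst_assoc,
        pullback.lift_snd_assoc]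
      exact IntGpd.assoc _ _ _ (IntGpd.pb_aux₂ F F' hfg) (IntGpd.pb_aux₂ F F' hgh)
  τ_d := by ext <;> simp [G.τ_d, H.τ_d]
  τ_c := by ext <;> simp [G.τ_c, H.τ_c]
  m_τ := by
    ext
    · simp only [Category.assoc, pullback.lift_fst, IntGpd.precomp]
      refine (IntGpd.comp_congr _ ?_ ?_).trans ((IntGpd.comp_inv (pullback.fst _ _)).trans ?_) <;>
        simp
    · simp only [Category.assoc, pullback.lift_snd, IntGpd.precomp]
      refine (IntGpd.comp_congr _ ?_ ?_).trans ((IntGpd.comp_inv (pullback.snd _ _)).trans ?_) <;>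
        simp
  τ_m := by
    ext
    · simp only [Category.assoc, pullback.lift_fst, IntGpd.precomp]
      refine (IntGpd.comp_congr _ ?_ ?_).trans ((IntGpd.inv_comp (pullback.fst _ _)).trans ?_) <;>
        simp
    · simp only [Category.assoc, pullback.lift_snd, IntGpd.precomp]
      refine (IntGpd.comp_congr _ ?_ ?_).trans ((IntGpd.inv_comp (pullback.snd _ _)).trans ?_) <;>
        simp

/-- The first projection of the pullback of internal groupoids. -/
noncomputable def IntGpd.pbFst {G H K : IntGpd E} (F : G ⟶ K) (F' : H ⟶ K) :
    IntGpd.pb F F' ⟶ G where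
  F₀ := pullback.fst _ _
  F₁ := pullback.fst _ _
  map_d := by simp [IntGpd.pb]
  map_c := by simp [IntGpd.pb]
  map_e := by simp [IntGpd.pb]
  map_m := by dsimp only [IntGpd.pb]; rw [pullback.lift_fst]

/-- The second projection of the pullback of internal groupoids. -/
noncomputable def IntGpd.pbSnd {G H K : IntGpd E} (F : G ⟶ K) (F' : H ⟶ K) :
    IntGpd.pb F F' ⟶ H where
  F₀ := pullback.snd _ _
  F₁ := pullback.snd _ _
  map_d := by simp [IntGpd.pb]
  map_c := by simp [IntGpd.pb]
  map_e := by simp [IntGpd.pb]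
  map_m := by dsimp only [IntGpd.pb]; rw [pullback.lift_snd]

/-- `F` is a discrete fibration when the square `c ∘ F₁ = F₀ ∘ c` is a pullback. -/
def IsDiscreteFibration {G H : IntGpd E} (F : G ⟶ H) : Prop :=
  IsPullback F.F₁ G.c H.c F.F₀

/-- `F` is final when it is left orthogonal to every discrete fibration: each commutative square
from `F` to a discrete fibration has exactly one diagonal filler. -/
def IsFinal {G H : IntGpd E} (F : G ⟶ H) : Prop :=
  ∀ ⦃X Y : IntGpd E⦄ (p : X ⟶ Y), IsDiscreteFibration p →
    ∀ (u : G ⟶ X) (v : H ⟶ Y), u ≫ p = F ≫ v → ∃! w : H ⟶ X, F ≫ w = u ∧ w ≫ p = v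

/-- The canonical comparison of `G₁` with the joint pullback of `d` and `c` along `F₀`. -/
noncomputable def fullComparison {G H : IntGpd E} (F : G ⟶ H) :
    G.C₁ ⟶ pullback (prod.map F.F₀ F.F₀) (prod.lift H.d H.c) :=
  pullback.lift (prod.lift G.d G.c) F.F₁ (by ext <;> simp [F.map_d, F.map_c])

/-- `F` is internally full. -/
def IsFull {G H : IntGpd E} (F : G ⟶ H) : Prop := IsRegularEpi (fullComparison F)

/-! ### Internal distributors and their spans -/

/-- An internal distributor from `A` to `B`. The left action is defined on pairs `(α, s)` with
`d α = L s`, the right action on pairs `(s, β)` with `R s = c β`; in sets one writes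
`α · s` and `s · β`, where `s : b ⇢ a`, `α : a ⟶ a'`, `β : b' ⟶ b`.
The associativity and compatibility axioms are stated on generalized elements. -/
structure Distributor (A B : IntGpd E) where
  S₀ : E
  L : S₀ ⟶ A.C₀
  R : S₀ ⟶ B.C₀
  lam : pullback A.d L ⟶ S₀
  rho : pullback R B.c ⟶ S₀
  lam_L : lam ≫ L = pullback.fst A.d L ≫ A.c
  lam_R : lam ≫ R = pullback.snd A.d L ≫ R
  rho_L : rho ≫ L = pullback.fst R B.c ≫ L
  rho_R : rho ≫ R = pullback.snd R B.c ≫ B.d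
  lam_unit : pullback.lift (L ≫ A.e) (𝟙 S₀)
    (by rw [Category.assoc, A.e_d, Category.comp_id, Category.id_comp]) ≫ lam = 𝟙 S₀
  rho_unit : pullback.lift (𝟙 S₀) (R ≫ B.e)
    (by rw [Category.assoc, B.e_c, Category.comp_id, Category.id_comp]) ≫ rho = 𝟙 S₀
  lam_assoc : ∀ {X : E} (α α' : X ⟶ A.C₁) (s : X ⟶ S₀) (h : α ≫ A.c = α' ≫ A.d)
    (hs : α ≫ A.d = s ≫ L),
    pullback.lift (A.comp α α' h) s (by rw [IntGpd.comp_d, hs]) ≫ lam =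
      pullback.lift α' (pullback.lift α s hs ≫ lam)
        (by rw [Category.assoc, lam_L, pullback.lift_fst_assoc, h]) ≫ lam
  rho_assoc : ∀ {X : E} (s : X ⟶ S₀) (β' β : X ⟶ B.C₁) (h : β' ≫ B.c = β ≫ B.d)
    (hs : s ≫ R = β ≫ B.c),
    pullback.lift s (B.comp β' β h) (by rw [IntGpd.comp_c, hs]) ≫ rho =
      pullback.lift (pullback.lift s β hs ≫ rho) β'
        (by rw [Category.assoc, rho_R, pullback.lift_snd_assoc, h]) ≫ rho
  compat : ∀ {X : E} (α : X ⟶ A.C₁) (s : X ⟶ S₀) (β : X ⟶ B.C₁) (h : α ≫ A.d = s ≫ L)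
    (h' : s ≫ R = β ≫ B.c),
    pullback.lift (pullback.lift α s h ≫ lam) β
        (by rw [Category.assoc, lam_R, pullback.lift_snd_assoc, h']) ≫ rho =
      pullback.lift α (pullback.lift s β h' ≫ rho)
        (by rw [Category.assoc, rho_L, pullback.lift_fst_assoc, h]) ≫ lam

namespace Distributor

variable {A B C : IntGpd E} (S : Distributor A B) {X Y : E}

/-- The left action `α · s` on generalized elements. -/
noncomputable def la (α : X ⟶ A.C₁) (s : X ⟶ S.S₀) (h : α ≫ A.d = s ≫ S.L) : X ⟶ S.S₀ :=
  pullback.lift α s h ≫ S.lam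

/-- The right action `s · β` on generalized elements. -/
noncomputable def ra (s : X ⟶ S.S₀) (β : X ⟶ B.C₁) (h : s ≫ S.R = β ≫ B.c) : X ⟶ S.S₀ :=
  pullback.lift s β h ≫ S.rho

variable {S}

lemma la_L (α : X ⟶ A.C₁) (s : X ⟶ S.S₀) (h : α ≫ A.d = s ≫ S.L) :
    S.la α s h ≫ S.L = α ≫ A.c := by simp [la, S.lam_L]

lemma la_R (α : X ⟶ A.C₁) (s : X ⟶ S.S₀) (h : α ≫ A.d = s ≫ S.L) :
    S.la α s h ≫ S.R = s ≫ S.R := by simp [la, S.lam_R]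

lemma ra_L (s : X ⟶ S.S₀) (β : X ⟶ B.C₁) (h : s ≫ S.R = β ≫ B.c) :
    S.ra s β h ≫ S.L = s ≫ S.L := by simp [ra, S.rho_L]

lemma ra_R (s : X ⟶ S.S₀) (β : X ⟶ B.C₁) (h : s ≫ S.R = β ≫ B.c) :
    S.ra s β h ≫ S.R = β ≫ B.d := by simp [ra, S.rho_R]

lemma la_congr {α α' : X ⟶ A.C₁} {s s' : X ⟶ S.S₀} (h : α ≫ A.d = s ≫ S.L) (hα : α = α')
    (hs : s = s') : S.la α s h = S.la α' s' (by rw [← hα, ← hs, h]) := by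
  subst hα hs; rfl

lemma ra_congr {β β' : X ⟶ B.C₁} {s s' : X ⟶ S.S₀} (h : s ≫ S.R = β ≫ B.c) (hs : s = s')
    (hβ : β = β') : S.ra s β h = S.ra s' β' (by rw [← hβ, ← hs, h]) := by
  subst hβ hs; rfl

lemma precomp_la (k : Y ⟶ X) (α : X ⟶ A.C₁) (s : X ⟶ S.S₀) (h : α ≫ A.d = s ≫ S.L) :
    k ≫ S.la α s h = S.la (k ≫ α) (k ≫ s) (by simp [h]) := by
  rw [la, la, ← Category.assoc]
  congr 1
  ext <;> simp

lemma precomp_ra (k : Y ⟶ X) (s : X ⟶ S.S₀) (β : X ⟶ B.C₁) (h : s ≫ S.R = β ≫ B.c) :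
    k ≫ S.ra s β h = S.ra (k ≫ s) (k ≫ β) (by simp [h]) := by
  rw [ra, ra, ← Category.assoc]
  congr 1
  ext <;> simp

lemma la_unit (s : X ⟶ S.S₀) (x : X ⟶ A.C₀) (h : s ≫ S.L = x) :
    S.la (x ≫ A.e) s (by simp [A.e_d, h]) = s := by
  subst h
  refine Eq.trans ?_ ((congrArg (fun t => s ≫ t) S.lam_unit).trans (Category.comp_id s))
  refine Eq.trans ?_ (Category.assoc _ _ _)
  rw [la]
  congr 1
  ext <;> simp

lemma ra_unit (s : X ⟶ S.S₀) (x : X ⟶ B.C₀) (h : s ≫ S.R = x) :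
    S.ra s (x ≫ B.e) (by simp [B.e_c, h]) = s := by
  subst h
  refine Eq.trans ?_ ((congrArg (fun t => s ≫ t) S.rho_unit).trans (Category.comp_id s))
  refine Eq.trans ?_ (Category.assoc _ _ _)
  rw [ra]
  congr 1
  ext <;> simp

lemma la_la (α α' : X ⟶ A.C₁) (s : X ⟶ S.S₀) (h : α ≫ A.c = α' ≫ A.d)
    (hs : α ≫ A.d = s ≫ S.L) :
    S.la (A.comp α α' h) s (by rw [IntGpd.comp_d, hs]) =
      S.la α' (S.la α s hs) (by rw [la_L, h]) := S.lam_assoc α α' s h hs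

lemma ra_ra (s : X ⟶ S.S₀) (β' β : X ⟶ B.C₁) (h : β' ≫ B.c = β ≫ B.d)
    (hs : s ≫ S.R = β ≫ B.c) :
    S.ra s (B.comp β' β h) (by rw [IntGpd.comp_c, hs]) =
      S.ra (S.ra s β hs) β' (by rw [ra_R, h]) := S.rho_assoc s β' β h hs

lemma la_ra (α : X ⟶ A.C₁) (s : X ⟶ S.S₀) (β : X ⟶ B.C₁) (h : α ≫ A.d = s ≫ S.L)
    (h' : s ≫ S.R = β ≫ B.c) :
    S.ra (S.la α s h) β (by rw [la_R, h']) = S.la α (S.ra s β h') (by rw [ra_L, h]) :=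
  S.compat α s β h h'

variable (S)

/-- The object `S₁` of commutative squares `α · s = s' · β`. -/
noncomputable abbrev Sq : E := pullback S.lam S.rho

/-- The component `α` of a square. -/
noncomputable def sqα : S.Sq ⟶ A.C₁ := pullback.fst S.lam S.rho ≫ pullback.fst A.d S.L

/-- The component `s` of a square. -/
noncomputable def sqs : S.Sq ⟶ S.S₀ := pullback.fst S.lam S.rho ≫ pullback.snd A.d S.L

/-- The component `s'` of a square. -/
noncomputable def sqs' : S.Sq ⟶ S.S₀ := pullback.snd S.lam S.rho ≫ pullback.fst S.R B.c

/-- The component `β` of a square. -/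
noncomputable def sqβ : S.Sq ⟶ B.C₁ := pullback.snd S.lam S.rho ≫ pullback.snd S.R B.c

lemma sqα_d : S.sqα ≫ A.d = S.sqs ≫ S.L := by
  simp [sqα, sqs, pullback.condition]

lemma sqβ_c : S.sqs' ≫ S.R = S.sqβ ≫ B.c := by
  simp [sqβ, sqs', pullback.condition]

lemma sq_comm : S.la S.sqα S.sqs S.sqα_d = S.ra S.sqs' S.sqβ S.sqβ_c := by
  refine Eq.trans ?_ ((pullback.condition (f := S.lam) (g := S.rho)).trans ?_)
  · rw [la]; congr 1; ext <;> simp [sqα, sqs]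
  · rw [ra]; congr 1; ext <;> simp [sqβ, sqs']

lemma sqα_c : S.sqα ≫ A.c = S.sqs' ≫ S.L := by
  rw [← la_L _ _ S.sqα_d, sq_comm, ra_L]

lemma sqβ_d : S.sqβ ≫ B.d = S.sqs ≫ S.R := by
  rw [← ra_R _ _ S.sqβ_c, ← sq_comm, la_R]

/-- The generalized element of `S₁` with given components. -/
noncomputable def sqMk (α : X ⟶ A.C₁) (s s' : X ⟶ S.S₀) (β : X ⟶ B.C₁) (h : α ≫ A.d = s ≫ S.L)
    (h' : s' ≫ S.R = β ≫ B.c) (w : S.la α s h = S.ra s' β h') : X ⟶ S.Sq :=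
  pullback.lift (pullback.lift α s h) (pullback.lift s' β h')
    (show pullback.lift α s h ≫ S.lam = pullback.lift s' β h' ≫ S.rho from w)

section
variable (α : X ⟶ A.C₁) (s s' : X ⟶ S.S₀) (β : X ⟶ B.C₁) (h : α ≫ A.d = s ≫ S.L)
    (h' : s' ≫ S.R = β ≫ B.c) (w : S.la α s h = S.ra s' β h')

@[simp] lemma sqMk_α : S.sqMk α s s' β h h' w ≫ S.sqα = α := by
  rw [sqMk, sqα, pullback.lift_fst_assoc, pullback.lift_fst]
@[simp] lemma sqMk_s : S.sqMk α s s' β h h' w ≫ S.sqs = s := by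
  rw [sqMk, sqs, pullback.lift_fst_assoc, pullback.lift_snd]
@[simp] lemma sqMk_s' : S.sqMk α s s' β h h' w ≫ S.sqs' = s' := by
  rw [sqMk, sqs', pullback.lift_snd_assoc, pullback.lift_fst]
@[simp] lemma sqMk_β : S.sqMk α s s' β h h' w ≫ S.sqβ = β := by
  rw [sqMk, sqβ, pullback.lift_snd_assoc, pullback.lift_snd]

end

variable {S} in
lemma sq_ext {f g : X ⟶ S.Sq} (hα : f ≫ S.sqα = g ≫ S.sqα) (hs : f ≫ S.sqs = g ≫ S.sqs)
    (hs' : f ≫ S.sqs' = g ≫ S.sqs') (hβ : f ≫ S.sqβ = g ≫ S.sqβ) : f = g := by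
  apply pullback.hom_ext <;> apply pullback.hom_ext <;>
    simpa only [sqα, sqs, sqs', sqβ, Category.assoc]

/-- Conditions for two squares being composable. -/
lemma sq_precond {f g : X ⟶ S.Sq} (h : f ≫ S.sqs' = g ≫ S.sqs) :
    (f ≫ S.sqα) ≫ A.c = (g ≫ S.sqα) ≫ A.d ∧ (f ≫ S.sqβ) ≫ B.c = (g ≫ S.sqβ) ≫ B.d := by
  simp [sqα_c, sqα_d, sqβ_d, ← sqβ_c, reassoc_of% h]

lemma sq_comp_aux {f g : X ⟶ S.Sq} (h : f ≫ S.sqs' = g ≫ S.sqs) :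
    S.la (A.comp (f ≫ S.sqα) (g ≫ S.sqα) (S.sq_precond h).1) (f ≫ S.sqs)
        (by rw [IntGpd.comp_d, Category.assoc, Category.assoc, sqα_d]) =
      S.ra (g ≫ S.sqs') (B.comp (f ≫ S.sqβ) (g ≫ S.sqβ) (S.sq_precond h).2)
        (by rw [IntGpd.comp_c, Category.assoc, Category.assoc, sqβ_c]) := by
  have hf : S.la (f ≫ S.sqα) (f ≫ S.sqs) (by simp [sqα_d]) =
      S.ra (g ≫ S.sqs) (f ≫ S.sqβ) (by simp [← h, sqβ_c]) := by
    rw [← precomp_la _ _ _ S.sqα_d, sq_comm, precomp_ra]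
    exact ra_congr _ h rfl
  have hg : S.la (g ≫ S.sqα) (g ≫ S.sqs) (by simp [sqα_d]) =
      S.ra (g ≫ S.sqs') (g ≫ S.sqβ) (by simp [sqβ_c]) := by
    rw [← precomp_la _ _ _ S.sqα_d, sq_comm, precomp_ra]
  rw [la_la _ _ _ _ (by simp [sqα_d]), ra_ra _ _ _ _ (by simp [sqβ_c]), la_congr _ rfl hf,
    ra_congr _ hg.symm rfl,
    la_ra _ _ _ (by simp [sqα_d]) (by simp [← h, sqβ_c])]

lemma sq_inv_aux : S.la (S.sqα ≫ A.τ) S.sqs' (by simp [A.τ_d, sqα_c]) =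
    S.ra S.sqs (S.sqβ ≫ B.τ) (by simp [B.τ_c, sqβ_d]) := by
  have h₁ : S.ra (S.la S.sqα S.sqs S.sqα_d) (S.sqβ ≫ B.τ) (by simp [B.τ_c, sqβ_d, la_R]) =
      S.sqs' := by
    rw [ra_congr _ S.sq_comm rfl, ← ra_ra _ _ _ (by simp [B.τ_c]),
      ra_congr _ rfl (IntGpd.inv_comp _)]
    simpa using ra_unit S.sqs' (S.sqβ ≫ B.c) S.sqβ_c
  rw [la_ra _ _ _ S.sqα_d (by simp [B.τ_c, sqβ_d])] at h₁
  rw [la_congr _ rfl h₁.symm, ← la_la _ _ _ (by simp [A.τ_d]), la_congr _ (IntGpd.comp_inv _) rfl]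
  simpa using la_unit (S.ra S.sqs (S.sqβ ≫ B.τ) (by simp [B.τ_c, sqβ_d])) (S.sqα ≫ A.d)
    (by simp [ra_L, sqα_d])

/-- The groupoid associated with a distributor: objects `S₀`, arrows the squares `S₁`, and
structure maps `(α, s, s', β) ↦ s` (domain) and `(α, s, s', β) ↦ s'` (codomain), with identities,
composition and inversion componentwise. -/
noncomputable def total : IntGpd E where
  C₀ := S.S₀
  C₁ := S.Sq
  d := S.sqs
  c := S.sqs'
  e := S.sqMk (S.L ≫ A.e) (𝟙 _) (𝟙 _) (S.R ≫ B.e) (by simp [A.e_d]) (by simp [B.e_c])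
    (by rw [la_unit _ _ (by simp), ra_unit _ _ (by simp)])
  m := S.sqMk _ _ _ _ _ _ (S.sq_comp_aux (pullback.condition (f := S.sqs') (g := S.sqs)))
  τ := S.sqMk (S.sqα ≫ A.τ) S.sqs' S.sqs (S.sqβ ≫ B.τ) (by simp [A.τ_d, sqα_c])
    (by simp [B.τ_c, sqβ_d]) S.sq_inv_aux
  e_d := by simp
  e_c := by simp
  m_d := by simp
  m_c := by simp
  id_m := by
    apply sq_ext
    · simp [IntGpd.precomp]
      refine (IntGpd.comp_congr _ ?_ ?_).trans (IntGpd.id_comp _ _ rfl) <;> simp [sqα_d]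
    · simp
    · simp
    · simp [IntGpd.precomp]
      refine (IntGpd.comp_congr _ ?_ ?_).trans (IntGpd.id_comp _ _ rfl) <;> simp [sqβ_d]
  m_id := by
    apply sq_ext
    · simp [IntGpd.precomp]
      refine (IntGpd.comp_congr _ ?_ ?_).trans (IntGpd.comp_id _ _ rfl) <;> simp [sqα_c]
    · simp
    · simp
    · simp [IntGpd.precomp]
      refine (IntGpd.comp_congr _ ?_ ?_).trans (IntGpd.comp_id _ _ rfl) <;>
        simp [reassoc_of% S.sqβ_c]
  m_assoc f g h hfg hgh := by
    apply sq_ext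
    · simp only [Category.assoc, sqMk_α, IntGpd.precomp, pullback.lift_fst_assoc,
        pullback.lift_snd_assoc]
      exact IntGpd.assoc _ _ _ (S.sq_precond hfg).1 (S.sq_precond hgh).1
    · simp
    · simp
    · simp only [Category.assoc, sqMk_β, IntGpd.precomp, pullback.lift_fst_assoc,
        pullback.lift_snd_assoc]
      exact IntGpd.assoc _ _ _ (S.sq_precond hfg).2 (S.sq_precond hgh).2
  τ_d := by simp
  τ_c := by simp
  m_τ := by
    apply sq_ext
    · simp [IntGpd.precomp]
      refine (IntGpd.comp_inv S.sqα).trans ?_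
      simp [reassoc_of% S.sqα_d]
    · simp
    · simp
    · simp [IntGpd.precomp]
      refine (IntGpd.comp_inv S.sqβ).trans ?_
      simp [reassoc_of% S.sqβ_d]
  τ_m := by
    apply sq_ext
    · simp [IntGpd.precomp]
      refine (IntGpd.inv_comp S.sqα).trans ?_
      simp [reassoc_of% S.sqα_c]
    · simp
    · simp
    · simp [IntGpd.precomp]
      refine (IntGpd.inv_comp S.sqβ).trans ?_
      simp [reassoc_of% S.sqβ_c]

/-- The left leg of the span of internal groupoids associated with a distributor. -/
noncomputable def legL : S.total ⟶ A where
  F₀ := S.L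
  F₁ := S.sqα
  map_d := S.sqα_d
  map_c := S.sqα_c
  map_e := by simp [total]
  map_m := by dsimp only [total]; rw [sqMk_α]

/-- The right leg of the span of internal groupoids associated with a distributor. -/
noncomputable def legR : S.total ⟶ B where
  F₀ := S.R
  F₁ := S.sqβ
  map_d := S.sqβ_d
  map_c := S.sqβ_c.symm
  map_e := by simp [total]
  map_m := by dsimp only [total]; rw [sqMk_β]

/-- The functor `⟨L, R⟩ : 𝕊 ⟶ A × B`. -/
noncomputable def leg : S.total ⟶ A.prod B := IntGpd.pair S.legL S.legR

variable (T : Distributor B C)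

/-- The composite `T ◇ S` of the spans associated with `S` and `T`. -/
noncomputable def spanComp : IntGpd E := IntGpd.pb S.legR T.legL

/-- The functor from the composite span `T ◇ S` to `A × C`. -/
noncomputable def spanCompLeg : S.spanComp T ⟶ A.prod C :=
  IntGpd.pair (IntGpd.pbFst S.legR T.legL ≫ S.legL) (IntGpd.pbSnd S.legR T.legL ≫ T.legR)

end Distributor

end Groupoids

section

variable {E : Type u} [Category.{v} E]

lemma hasCoequalizer_of_exists {G₁ G₀ : E} {d c : G₁ ⟶ G₀}
    (H : ∃ (Q : E) (q : G₀ ⟶ Q) (w : d ≫ q = c ≫ q), Nonempty (IsColimit (Cofork.ofπ q w)) ∧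
      ∀ {X : E} (x y : X ⟶ G₀), x ≫ q = y ≫ q →
        ∃ (X' : E) (p : X' ⟶ X) (h : X' ⟶ G₁),
          IsRegularEpi p ∧ h ≫ d = p ≫ x ∧ h ≫ c = p ≫ y) :
    HasCoequalizer d c := by
  obtain ⟨Q, q, w, ⟨hq⟩, -⟩ := H
  exact ⟨⟨⟨_, hq⟩⟩⟩

lemma exists_cover_of_exists {G₁ G₀ : E} {d c : G₁ ⟶ G₀} [HasCoequalizer d c]
    (H : ∃ (Q : E) (q : G₀ ⟶ Q) (w : d ≫ q = c ≫ q), Nonempty (IsColimit (Cofork.ofπ q w)) ∧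
      ∀ {X : E} (x y : X ⟶ G₀), x ≫ q = y ≫ q →
        ∃ (X' : E) (p : X' ⟶ X) (h : X' ⟶ G₁), IsRegularEpi p ∧ h ≫ d = p ≫ x ∧ h ≫ c = p ≫ y)
    {X : E} (x y : X ⟶ G₀) (hxy : x ≫ coequalizer.π d c = y ≫ coequalizer.π d c) :
    ∃ (X' : E) (p : X' ⟶ X) (h : X' ⟶ G₁),
      IsRegularEpi p ∧ h ≫ d = p ≫ x ∧ h ≫ c = p ≫ y := by
  obtain ⟨Q, q, w, -, H⟩ := H
  refine H x y ?_
  rw [← coequalizer.π_desc q w, reassoc_of% hxy]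

/-- Morphisms descend along a regular epimorphism. -/
lemma exists_desc {X Y Z : E} (f : X ⟶ Y) [IsRegularEpi f] (g : X ⟶ Z)
    (h : ∀ {W : E} (u v : W ⟶ X), u ≫ f = v ≫ f → u ≫ g = v ≫ g) : ∃ k : Y ⟶ Z, f ≫ k = g := by
  have r := IsRegularEpi.getStruct f
  exact ⟨Cofork.IsColimit.desc r.isColimit g (h _ _ r.w),
    Cofork.IsColimit.π_desc' r.isColimit g (h _ _ r.w)⟩

end

/-! ### Quotients of internal groupoids and composition of distributors -/

section Exact

attribute [local simp] pullback.lift_fst pullback.lift_snd pullback.lift_fst_assoc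
  pullback.lift_snd_assoc prod.lift_fst prod.lift_snd prod.lift_fst_assoc prod.lift_snd_assoc

variable {E : Type u} [Category.{v} E] [BarrExact E]

/-- In a Barr-exact category, a reflexive, symmetric and transitive pair has a coequalizer `q`, and
two generalized elements identified by `q` are, after a regular epimorphic covering, related by
the pair. -/
lemma exists_quotient {G₁ G₀ : E} (d c : G₁ ⟶ G₀) (r : G₀ ⟶ G₁) (rd : r ≫ d = 𝟙 _)
    (rc : r ≫ c = 𝟙 _) (t : G₁ ⟶ G₁) (td : t ≫ d = c) (tc : t ≫ c = d)
    (m : pullback c d ⟶ G₁) (md : m ≫ d = pullback.fst c d ≫ d)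
    (mc : m ≫ c = pullback.snd c d ≫ c) :
    ∃ (Q : E) (q : G₀ ⟶ Q) (w : d ≫ q = c ≫ q), Nonempty (IsColimit (Cofork.ofπ q w)) ∧
      ∀ {X : E} (x y : X ⟶ G₀), x ≫ q = y ≫ q →
        ∃ (X' : E) (p : X' ⟶ X) (h : X' ⟶ G₁), IsRegularEpi p ∧ h ≫ d = p ≫ x ∧ h ≫ c = p ≫ y := by
  obtain ⟨I, j, e, hj, he, hje⟩ : ∃ (I : E) (j : I ⟶ G₀ ⨯ G₀) (e : G₁ ⟶ I), Mono j ∧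
      IsRegularEpi e ∧ e ≫ j = prod.lift d c :=
    let F := Regular.strongEpiMonoFactorisation (prod.lift d c)
    ⟨F.I, F.m, F.e, F.m_mono, inferInstanceAs
      (IsRegularEpi (Regular.strongEpiMonoFactorisation (prod.lift d c)).e), F.fac⟩
  have e₁ : e ≫ j ≫ prod.fst = d := by rw [reassoc_of% hje, prod.lift_fst]
  have e₂ : e ≫ j ≫ prod.snd = c := by rw [reassoc_of% hje, prod.lift_snd]
  have sqs : CommSq (t ≫ e) e j (j ≫ prod.lift prod.snd prod.fst) := ⟨by
    ext <;> simp [e₁, e₂, td, tc]⟩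
  let k₁ := pullback.fst (pullback.fst (j ≫ prod.snd) (j ≫ prod.fst)) e
  let u := pullback.snd (pullback.fst (j ≫ prod.snd) (j ≫ prod.fst)) e
  let k₂ := pullback.fst (k₁ ≫ pullback.snd (j ≫ prod.snd) (j ≫ prod.fst)) e
  let v := pullback.snd (k₁ ≫ pullback.snd (j ≫ prod.snd) (j ≫ prod.fst)) e
  have hu : k₁ ≫ pullback.fst (j ≫ prod.snd) (j ≫ prod.fst) = u ≫ e := pullback.condition
  have hv : k₂ ≫ k₁ ≫ pullback.snd (j ≫ prod.snd) (j ≫ prod.fst) = v ≫ e := by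
    exact pullback.condition (f := k₁ ≫ pullback.snd (j ≫ prod.snd) (j ≫ prod.fst)) (g := e)
  have huv : (k₂ ≫ u) ≫ c = v ≫ d := by
    rw [← e₁, ← reassoc_of% hv, ← pullback.condition (f := j ≫ prod.snd) (g := j ≫ prod.fst),
      reassoc_of% hu, e₂, Category.assoc]
  have sqt : CommSq (pullback.lift (k₂ ≫ u) v huv ≫ m ≫ e) (k₂ ≫ k₁) j
      (prod.lift (pullback.fst (j ≫ prod.snd) (j ≫ prod.fst) ≫ j ≫ prod.fst)
        (pullback.snd (j ≫ prod.snd) (j ≫ prod.fst) ≫ j ≫ prod.snd)) := ⟨by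
    ext
    · simp [e₁, md, reassoc_of% hu]
    · simp [e₂, mc, reassoc_of% hv]⟩
  have : StrongEpi (k₂ ≫ k₁) := strongEpi_comp _ _
  have t₁ : sqt.lift ≫ j ≫ prod.fst =
      pullback.fst (j ≫ prod.snd) (j ≫ prod.fst) ≫ j ≫ prod.fst := by
    rw [sqt.fac_right_assoc, prod.lift_fst]
  have t₂ : sqt.lift ≫ j ≫ prod.snd =
      pullback.snd (j ≫ prod.snd) (j ≫ prod.fst) ≫ j ≫ prod.snd := by
    rw [sqt.fac_right_assoc, prod.lift_snd]
  have eqv : EquivalenceRelation (j ≫ prod.fst) (j ≫ prod.snd) :=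
    { right_cancellation := fun Y f g h₁ h₂ => by
        rw [← cancel_mono j]; ext <;> simpa
      r := r ≫ e
      reflexivity₁ := by simp [e₁, rd]
      reflexivity₂ := by simp [e₂, rc]
      s := sqs.lift
      symmetry₁ := by rw [sqs.fac_right_assoc]; simp
      symmetry₂ := by rw [sqs.fac_right_assoc]; simp
      c := _
      isLimit := pullbackIsPullback (j ≫ prod.snd) (j ≫ prod.fst)
      t := sqt.lift
      transitivity₁ := t₁
      transitivity₂ := t₂ }
  obtain ⟨⟨eff⟩⟩ := BarrExact.effective _ _ eqv.isEquivalenceRelation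
  have w : d ≫ eff.π = c ≫ eff.π := by
    have := congrArg (fun t => e ≫ t) eff.isKernelPair.w
    simpa [reassoc_of% e₁, reassoc_of% e₂] using this
  refine ⟨eff.B, eff.π, w, ⟨?_⟩, ?_⟩
  · refine Cofork.IsColimit.mk' _ fun s => ?_
    have hs : (j ≫ prod.fst) ≫ s.π = (j ≫ prod.snd) ≫ s.π := by
      rw [← cancel_epi e]
      simpa [reassoc_of% e₁, reassoc_of% e₂] using s.condition
    refine ⟨Cofork.IsColimit.desc eff.isCoequalizer s.π hs,
      Cofork.IsColimit.π_desc' eff.isCoequalizer s.π hs, fun {m} hm => ?_⟩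
    apply Cofork.IsColimit.hom_ext eff.isCoequalizer
    exact hm.trans (Cofork.IsColimit.π_desc' eff.isCoequalizer s.π hs).symm
  · intro X x y hxy
    let k := eff.isKernelPair.lift x y hxy
    refine ⟨_, pullback.fst k e, pullback.snd k e, inferInstance, ?_, ?_⟩
    · rw [← e₁, ← pullback.condition_assoc, eff.isKernelPair.lift_fst]
    · rw [← e₂, ← pullback.condition_assoc, eff.isKernelPair.lift_snd]

instance (G : IntGpd E) : HasCoequalizer G.d G.c :=
  hasCoequalizer_of_exists
    (exists_quotient G.d G.c G.e G.e_d G.e_c G.τ G.τ_d G.τ_c G.m G.m_d G.m_c)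

/-- The object of connected components of an internal groupoid. -/
noncomputable def Pi0 (G : IntGpd E) : E := coequalizer G.d G.c

/-- The action of `Π₀` on internal functors. -/
noncomputable def Pi0.map {G H : IntGpd E} (F : G ⟶ H) : Pi0 G ⟶ Pi0 H :=
  show coequalizer G.d G.c ⟶ coequalizer H.d H.c from
    coequalizer.desc (F.F₀ ≫ coequalizer.π H.d H.c) (by
      rw [← reassoc_of% F.map_d, ← reassoc_of% F.map_c, coequalizer.condition])

/-- `F` is internally essentially surjective: `Π₀(F)` is an isomorphism. -/
def IsEssSurj {G H : IntGpd E} (F : G ⟶ H) : Prop := IsIso (Pi0.map F)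

namespace Distributor

variable {A B C : IntGpd E} (S : Distributor A B) (T : Distributor B C) {X Y : E}

/-- The object `S₀ ×_{B₀} T₀` of pairs `(s, t)`. -/
noncomputable abbrev Pairs : E := pullback S.R T.L

/-- The object `S₀ ×_{B₀} B₁ ×_{B₀} T₀` of triples `(s, β, t)` with `R s = c β` and `d β = L t`. -/
noncomputable abbrev Triples : E := pullback (pullback.snd S.R B.c ≫ B.d) T.L

/-- The component `s` of a triple. -/
noncomputable def trs : S.Triples T ⟶ S.S₀ :=
  pullback.fst (pullback.snd S.R B.c ≫ B.d) T.L ≫ pullback.fst S.R B.c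

/-- The component `β` of a triple. -/
noncomputable def trβ : S.Triples T ⟶ B.C₁ :=
  pullback.fst (pullback.snd S.R B.c ≫ B.d) T.L ≫ pullback.snd S.R B.c

/-- The component `t` of a triple. -/
noncomputable def trt : S.Triples T ⟶ T.S₀ :=
  pullback.snd (pullback.snd S.R B.c ≫ B.d) T.L

lemma trs_R : S.trs T ≫ S.R = S.trβ T ≫ B.c := by simp [trs, trβ, pullback.condition]

lemma trt_L : S.trβ T ≫ B.d = S.trt T ≫ T.L := by
  rw [trt, trβ, ← pullback.condition, Category.assoc]

/-- The generalized triple with given components. -/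
noncomputable def trMk (s : X ⟶ S.S₀) (β : X ⟶ B.C₁) (t : X ⟶ T.S₀) (h : s ≫ S.R = β ≫ B.c)
    (h' : β ≫ B.d = t ≫ T.L) : X ⟶ S.Triples T :=
  pullback.lift (pullback.lift s β h) t (by rw [pullback.lift_snd_assoc, h'])

section
variable (s : X ⟶ S.S₀) (β : X ⟶ B.C₁) (t : X ⟶ T.S₀) (h : s ≫ S.R = β ≫ B.c)
    (h' : β ≫ B.d = t ≫ T.L)

@[simp] lemma trMk_s : S.trMk T s β t h h' ≫ S.trs T = s := by
  rw [trMk, trs, pullback.lift_fst_assoc, pullback.lift_fst]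
@[simp] lemma trMk_β : S.trMk T s β t h h' ≫ S.trβ T = β := by
  rw [trMk, trβ, pullback.lift_fst_assoc, pullback.lift_snd]
@[simp] lemma trMk_t : S.trMk T s β t h h' ≫ S.trt T = t := by
  rw [trMk, trt, pullback.lift_snd]

end

/-- The morphism `ρ_S × id`, sending `(s, β, t)` to `(s · β, t)`. -/
noncomputable def hd : S.Triples T ⟶ S.Pairs T :=
  pullback.lift (S.ra (S.trs T) (S.trβ T) (S.trs_R T)) (S.trt T) (by rw [ra_R, trt_L])

/-- The morphism `id × λ_T`, sending `(s, β, t)` to `(s, β · t)`. -/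
noncomputable def hc : S.Triples T ⟶ S.Pairs T :=
  pullback.lift (S.trs T) (T.la (S.trβ T) (S.trt T) (S.trt_L T)) (by rw [la_L, trs_R])

@[simp] lemma hd_fst : S.hd T ≫ pullback.fst S.R T.L = S.ra (S.trs T) (S.trβ T) (S.trs_R T) := by
  simp [hd]
@[simp] lemma hd_snd : S.hd T ≫ pullback.snd S.R T.L = S.trt T := by simp [hd]
@[simp] lemma hc_fst : S.hc T ≫ pullback.fst S.R T.L = S.trs T := by simp [hc]
@[simp] lemma hc_snd : S.hc T ≫ pullback.snd S.R T.L = T.la (S.trβ T) (S.trt T) (S.trt_L T) := by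
  simp [hc]

lemma hd_fst' (h : X ⟶ S.Triples T) : (h ≫ S.hd T) ≫ pullback.fst S.R T.L =
    S.ra (h ≫ S.trs T) (h ≫ S.trβ T) (by simp [trs_R]) := by
  rw [Category.assoc, hd_fst, precomp_ra]

lemma hc_snd' (h : X ⟶ S.Triples T) : (h ≫ S.hc T) ≫ pullback.snd S.R T.L =
    T.la (h ≫ S.trβ T) (h ≫ S.trt T) (by simp [trt_L]) := by
  rw [Category.assoc, hc_snd, precomp_la]

lemma tr_comp_aux {f g : X ⟶ S.Triples T} (h : f ≫ S.hc T = g ≫ S.hd T) :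
    f ≫ S.trs T = S.ra (g ≫ S.trs T) (g ≫ S.trβ T) (by simp [trs_R]) ∧
    T.la (f ≫ S.trβ T) (f ≫ S.trt T) (by simp [trt_L]) = g ≫ S.trt T := by
  constructor
  · have := congrArg (fun t => t ≫ pullback.fst S.R T.L) h
    simpa [precomp_ra] using this
  · have := congrArg (fun t => t ≫ pullback.snd S.R T.L) h
    simpa [precomp_la] using this

lemma tr_comp_aux' {f g : X ⟶ S.Triples T} (h : f ≫ S.hc T = g ≫ S.hd T) :
    (f ≫ S.trβ T) ≫ B.c = (g ≫ S.trβ T) ≫ B.d := by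
  rw [Category.assoc, ← trs_R, ← Category.assoc, (S.tr_comp_aux T h).1, ra_R]

lemma tensor_exists_quotient :
    ∃ (Q : E) (q : S.Pairs T ⟶ Q) (w : S.hd T ≫ q = S.hc T ≫ q),
      Nonempty (IsColimit (Cofork.ofπ q w)) ∧
      ∀ {X : E} (x y : X ⟶ S.Pairs T), x ≫ q = y ≫ q →
        ∃ (X' : E) (p : X' ⟶ X) (h : X' ⟶ S.Triples T),
          IsRegularEpi p ∧ h ≫ S.hd T = p ≫ x ∧ h ≫ S.hc T = p ≫ y := by
  have hm := S.tr_comp_aux T (pullback.condition (f := S.hc T) (g := S.hd T))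
  have hm' := S.tr_comp_aux' T (pullback.condition (f := S.hc T) (g := S.hd T))
  refine exists_quotient (S.hd T) (S.hc T)
    (S.trMk T (pullback.fst _ _) ((pullback.fst _ _ ≫ S.R) ≫ B.e) (pullback.snd _ _)
      (by simp [B.e_c]) (by simp [B.e_d, pullback.condition])) ?_ ?_
    (S.trMk T (S.ra (S.trs T) (S.trβ T) (S.trs_R T)) (S.trβ T ≫ B.τ)
      (T.la (S.trβ T) (S.trt T) (S.trt_L T)) (by simp [ra_R, B.τ_c]) (by simp [la_L, B.τ_d])) ?_ ?_
    (S.trMk T (pullback.snd (S.hc T) (S.hd T) ≫ S.trs T)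
      (B.comp (pullback.fst (S.hc T) (S.hd T) ≫ S.trβ T)
        (pullback.snd (S.hc T) (S.hd T) ≫ S.trβ T) hm')
      (pullback.fst (S.hc T) (S.hd T) ≫ S.trt T)
      (by simp [IntGpd.comp_c, trs_R]) (by simp [IntGpd.comp_d, trt_L])) ?_ ?_
  · ext
    · rw [hd_fst']
      refine (ra_congr _ ?_ ?_).trans ((ra_unit _ _ rfl).trans (Category.id_comp _).symm) <;> simp
    · simp
  · ext
    · simp
    · rw [hc_snd']
      refine (la_congr _ ?_ ?_).trans ((la_unit (S := T) _ _
        (pullback.condition (f := S.R) (g := T.L)).symm).trans (Category.id_comp _).symm) <;> simp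
  · ext
    · rw [hd_fst', ra_congr _ (trMk_s ..) (trMk_β ..),
        ← ra_ra _ _ _ (by simp [B.τ_c]), ra_congr _ rfl (IntGpd.inv_comp _), hc_fst]
      simpa using ra_unit (S.trs T) (S.trβ T ≫ B.c) (S.trs_R T)
    · simp
  · ext
    · simp
    · rw [hc_snd', la_congr _ (trMk_β ..) (trMk_t ..),
        ← la_la _ _ _ (by simp [B.τ_d]), la_congr _ (IntGpd.comp_inv _) rfl, hd_snd]
      simpa using la_unit (S.trt T) (S.trβ T ≫ B.d) (S.trt_L T).symm
  · ext
    · rw [hd_fst', ra_congr _ (trMk_s ..) (trMk_β ..),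
        ra_ra _ _ _ _ (by simp [trs_R]), hd_fst']
      exact ra_congr _ hm.1.symm rfl
    · simp
  · ext
    · simp
    · rw [hc_snd', la_congr _ (trMk_β ..) (trMk_t ..),
        la_la _ _ _ _ (by simp [trt_L]), hc_snd']
      exact la_congr _ rfl hm.2

instance : HasCoequalizer (S.hd T) (S.hc T) := hasCoequalizer_of_exists (S.tensor_exists_quotient T)

/-- The object `(T ⊗ S)₀`: the coequalizer of `ρ_S × id` and `id × λ_T`. -/
noncomputable def tensorObj : E := coequalizer (S.hd T) (S.hc T)

/-- The coequalizer `Q₀ : S₀ ×_{B₀} T₀ ⟶ (T ⊗ S)₀`. -/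
noncomputable def tensorπ : S.Pairs T ⟶ S.tensorObj T := coequalizer.π (S.hd T) (S.hc T)

/-- The induced leg `(T ⊗ S)₀ ⟶ A₀`. -/
noncomputable def tensorL : S.tensorObj T ⟶ A.C₀ :=
  coequalizer.desc (pullback.fst S.R T.L ≫ S.L) (by
    rw [← Category.assoc, ← Category.assoc, hd_fst, hc_fst, ra_L])

/-- The induced leg `(T ⊗ S)₀ ⟶ C₀`. -/
noncomputable def tensorR : S.tensorObj T ⟶ C.C₀ :=
  coequalizer.desc (pullback.snd S.R T.L ≫ T.R) (by
    rw [← Category.assoc, ← Category.assoc, hd_snd, hc_snd, la_R])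

@[simp] lemma tensorπ_L : S.tensorπ T ≫ S.tensorL T = pullback.fst S.R T.L ≫ S.L :=
  coequalizer.π_desc _ _

@[simp] lemma tensorπ_R : S.tensorπ T ≫ S.tensorR T = pullback.snd S.R T.L ≫ T.R :=
  coequalizer.π_desc _ _

instance : IsRegularEpi (S.tensorπ T) :=
  inferInstanceAs (IsRegularEpi (coequalizer.π (S.hd T) (S.hc T)))

section
variable {S}

/-- `α · (s, t) = (α · s, t)`. -/
noncomputable def pla (α : X ⟶ A.C₁) (z : X ⟶ S.Pairs T)
    (h : α ≫ A.d = z ≫ pullback.fst S.R T.L ≫ S.L) : X ⟶ S.Pairs T :=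
  pullback.lift (S.la α (z ≫ pullback.fst S.R T.L) (by rw [h, Category.assoc]))
    (z ≫ pullback.snd S.R T.L)
    (by rw [la_R, Category.assoc, Category.assoc, pullback.condition])

/-- `(s, t) · γ = (s, t · γ)`. -/
noncomputable def pra (z : X ⟶ S.Pairs T) (γ : X ⟶ C.C₁)
    (h : z ≫ pullback.snd S.R T.L ≫ T.R = γ ≫ C.c) : X ⟶ S.Pairs T :=
  pullback.lift (z ≫ pullback.fst S.R T.L)
    (T.ra (z ≫ pullback.snd S.R T.L) γ (by rw [← h, Category.assoc]))
    (by rw [ra_L, Category.assoc, Category.assoc, pullback.condition])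

variable {T}

@[simp] lemma pla_fst (α : X ⟶ A.C₁) (z : X ⟶ S.Pairs T)
    (h : α ≫ A.d = z ≫ pullback.fst S.R T.L ≫ S.L) :
    pla T α z h ≫ pullback.fst S.R T.L =
      S.la α (z ≫ pullback.fst S.R T.L) (by rw [h, Category.assoc]) := by simp [pla]

@[simp] lemma pla_snd (α : X ⟶ A.C₁) (z : X ⟶ S.Pairs T)
    (h : α ≫ A.d = z ≫ pullback.fst S.R T.L ≫ S.L) :
    pla T α z h ≫ pullback.snd S.R T.L = z ≫ pullback.snd S.R T.L := by simp [pla]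

@[simp] lemma pra_fst (z : X ⟶ S.Pairs T) (γ : X ⟶ C.C₁)
    (h : z ≫ pullback.snd S.R T.L ≫ T.R = γ ≫ C.c) :
    pra T z γ h ≫ pullback.fst S.R T.L = z ≫ pullback.fst S.R T.L := by simp [pra]

@[simp] lemma pra_snd (z : X ⟶ S.Pairs T) (γ : X ⟶ C.C₁)
    (h : z ≫ pullback.snd S.R T.L ≫ T.R = γ ≫ C.c) :
    pra T z γ h ≫ pullback.snd S.R T.L =
      T.ra (z ≫ pullback.snd S.R T.L) γ (by rw [← h, Category.assoc]) := by simp [pra]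

lemma pla_π_L (α : X ⟶ A.C₁) (z : X ⟶ S.Pairs T)
    (h : α ≫ A.d = z ≫ pullback.fst S.R T.L ≫ S.L) :
    pla T α z h ≫ S.tensorπ T ≫ S.tensorL T = α ≫ A.c := by
  rw [tensorπ_L, ← Category.assoc, pla_fst, la_L]

lemma pra_π_R (z : X ⟶ S.Pairs T) (γ : X ⟶ C.C₁)
    (h : z ≫ pullback.snd S.R T.L ≫ T.R = γ ≫ C.c) :
    pra T z γ h ≫ S.tensorπ T ≫ S.tensorR T = γ ≫ C.d := by
  rw [tensorπ_R, ← Category.assoc, pra_snd, ra_R]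

lemma precomp_pla (k : Y ⟶ X) (α : X ⟶ A.C₁) (z : X ⟶ S.Pairs T)
    (h : α ≫ A.d = z ≫ pullback.fst S.R T.L ≫ S.L) :
    k ≫ pla T α z h = pla T (k ≫ α) (k ≫ z) (by simp [h]) := by
  ext <;> simp [precomp_la]

lemma precomp_pra (k : Y ⟶ X) (z : X ⟶ S.Pairs T) (γ : X ⟶ C.C₁)
    (h : z ≫ pullback.snd S.R T.L ≫ T.R = γ ≫ C.c) :
    k ≫ pra T z γ h = pra T (k ≫ z) (k ≫ γ) (by simp [h]) := by
  ext <;> simp [precomp_ra]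

lemma pla_congr {α α' : X ⟶ A.C₁} {z z' : X ⟶ S.Pairs T}
    (h : α ≫ A.d = z ≫ pullback.fst S.R T.L ≫ S.L) (hα : α = α') (hz : z = z') :
    pla T α z h = pla T α' z' (by rw [← hα, ← hz, h]) := by subst hα hz; rfl

lemma pra_congr {γ γ' : X ⟶ C.C₁} {z z' : X ⟶ S.Pairs T}
    (h : z ≫ pullback.snd S.R T.L ≫ T.R = γ ≫ C.c) (hz : z = z') (hγ : γ = γ') :
    pra T z γ h = pra T z' γ' (by rw [← hγ, ← hz, h]) := by subst hγ hz; rfl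

lemma exists_triple (x y : X ⟶ S.Pairs T) (hxy : x ≫ S.tensorπ T = y ≫ S.tensorπ T) :
    ∃ (X' : E) (p : X' ⟶ X) (h : X' ⟶ S.Triples T),
      IsRegularEpi p ∧ h ≫ S.hd T = p ≫ x ∧ h ≫ S.hc T = p ≫ y :=
  exists_cover_of_exists (S.tensor_exists_quotient T) x y hxy

lemma hd_π : S.hd T ≫ S.tensorπ T = S.hc T ≫ S.tensorπ T := coequalizer.condition _ _

lemma pla_π_eq (α : X ⟶ A.C₁) (x y : X ⟶ S.Pairs T)
    (hx : α ≫ A.d = x ≫ pullback.fst S.R T.L ≫ S.L)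
    (hy : α ≫ A.d = y ≫ pullback.fst S.R T.L ≫ S.L)
    (hxy : x ≫ S.tensorπ T = y ≫ S.tensorπ T) :
    pla T α x hx ≫ S.tensorπ T = pla T α y hy ≫ S.tensorπ T := by
  obtain ⟨X', p, h, hp, h₁, h₂⟩ := exists_triple x y hxy
  have hα : (p ≫ α) ≫ A.d = (h ≫ S.trs T) ≫ S.L := by
    rw [Category.assoc, hy, ← reassoc_of% h₂, reassoc_of% S.hc_fst T, Category.assoc]
  let h' : X' ⟶ S.Triples T := S.trMk T (S.la (p ≫ α) (h ≫ S.trs T) hα) (h ≫ S.trβ T)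
    (h ≫ S.trt T) (by rw [la_R, Category.assoc, Category.assoc, trs_R])
    (by rw [Category.assoc, Category.assoc, trt_L])
  have e₁ : h' ≫ S.hd T = p ≫ pla T α x hx := by
    rw [precomp_pla]
    ext
    · rw [hd_fst', pla_fst, ra_congr _ (trMk_s ..) (trMk_β ..),
        la_ra _ _ _ hα (by simp [trs_R])]
      refine la_congr _ rfl ?_
      rw [← h₁, hd_fst']
    · rw [Category.assoc, hd_snd, pla_snd, ← h₁, Category.assoc, hd_snd, trMk_t]
  have e₂ : h' ≫ S.hc T = p ≫ pla T α y hy := by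
    rw [precomp_pla]
    ext
    · rw [Category.assoc, hc_fst, pla_fst, trMk_s]
      refine la_congr _ rfl ?_
      rw [← h₂, Category.assoc, hc_fst]
    · rw [Category.assoc, hc_snd, pla_snd, ← h₂, hc_snd', precomp_la]
      exact la_congr _ (trMk_β ..) (trMk_t ..)
  rw [← cancel_epi p, ← reassoc_of% e₁, ← reassoc_of% e₂, hd_π]

lemma pra_π_eq (γ : X ⟶ C.C₁) (x y : X ⟶ S.Pairs T)
    (hx : x ≫ pullback.snd S.R T.L ≫ T.R = γ ≫ C.c)
    (hy : y ≫ pullback.snd S.R T.L ≫ T.R = γ ≫ C.c)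
    (hxy : x ≫ S.tensorπ T = y ≫ S.tensorπ T) :
    pra T x γ hx ≫ S.tensorπ T = pra T y γ hy ≫ S.tensorπ T := by
  obtain ⟨X', p, h, hp, h₁, h₂⟩ := exists_triple x y hxy
  have hγ : (h ≫ S.trt T) ≫ T.R = (p ≫ γ) ≫ C.c := by
    rw [Category.assoc p, ← hx, ← reassoc_of% h₁, reassoc_of% S.hd_snd T, Category.assoc]
  let h' : X' ⟶ S.Triples T := S.trMk T (h ≫ S.trs T) (h ≫ S.trβ T)
    (T.ra (h ≫ S.trt T) (p ≫ γ) hγ) (by rw [Category.assoc, Category.assoc, trs_R])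
    (by rw [ra_L, Category.assoc, Category.assoc, trt_L])
  have e₁ : h' ≫ S.hd T = p ≫ pra T x γ hx := by
    rw [precomp_pra]
    ext
    · rw [Category.assoc, hd_fst, pra_fst, ← h₁, hd_fst', precomp_ra]
      exact ra_congr _ (trMk_s ..) (trMk_β ..)
    · rw [Category.assoc, hd_snd, pra_snd, trMk_t]
      refine ra_congr _ ?_ rfl
      rw [← h₁, Category.assoc, hd_snd]
  have e₂ : h' ≫ S.hc T = p ≫ pra T y γ hy := by
    rw [precomp_pra]
    ext
    · rw [Category.assoc, hc_fst, pra_fst, ← h₂, Category.assoc, hc_fst, trMk_s]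
    · rw [hc_snd', pra_snd, la_congr _ (trMk_β ..) (trMk_t ..),
        ← la_ra _ _ _ (by simp [trt_L]) hγ]
      refine ra_congr _ ?_ rfl
      rw [← h₂, hc_snd']
  rw [← cancel_epi p, ← reassoc_of% e₁, ← reassoc_of% e₂, hd_π]

end

lemma exists_tensorLam : ∃ l : pullback A.d (S.tensorL T) ⟶ S.tensorObj T,
    ∀ {X : E} (α : X ⟶ A.C₁) (z : X ⟶ S.Pairs T)
      (h : α ≫ A.d = z ≫ pullback.fst S.R T.L ≫ S.L),
      pullback.lift α (z ≫ S.tensorπ T) (by rw [h, Category.assoc, tensorπ_L]) ≫ l =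
        pla T α z h ≫ S.tensorπ T := by
  let f := pullback.fst (pullback.snd A.d (S.tensorL T)) (S.tensorπ T)
  let z₀ := pullback.snd (pullback.snd A.d (S.tensorL T)) (S.tensorπ T)
  have hf : f ≫ pullback.snd A.d (S.tensorL T) = z₀ ≫ S.tensorπ T := pullback.condition
  have h₀ : (f ≫ pullback.fst A.d (S.tensorL T)) ≫ A.d =
      z₀ ≫ pullback.fst S.R T.L ≫ S.L := by
    rw [Category.assoc, pullback.condition, reassoc_of% hf, tensorπ_L]
  obtain ⟨l, hl⟩ := exists_desc f (pla T _ z₀ h₀ ≫ S.tensorπ T) (by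
    intro W u v huv
    rw [← Category.assoc, ← Category.assoc, precomp_pla, precomp_pla,
      pla_congr _ (show _ = v ≫ f ≫ _ by rw [reassoc_of% huv]) rfl]
    apply pla_π_eq
    rw [Category.assoc, Category.assoc, ← hf, reassoc_of% huv])
  refine ⟨l, fun {X} α z h => ?_⟩
  let k := pullback.lift (f := pullback.snd A.d (S.tensorL T)) (g := S.tensorπ T)
    (pullback.lift α (z ≫ S.tensorπ T) (by rw [h, Category.assoc, tensorπ_L])) z
    (by rw [pullback.lift_snd])
  have k₁ : k ≫ f = pullback.lift α (z ≫ S.tensorπ T)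
    (by rw [h, Category.assoc, tensorπ_L]) := pullback.lift_fst ..
  have k₂ : k ≫ z₀ = z := pullback.lift_snd ..
  rw [← k₁, Category.assoc, hl, ← Category.assoc, precomp_pla]
  congr 1
  refine pla_congr _ ?_ k₂
  rw [reassoc_of% k₁, pullback.lift_fst]

lemma exists_tensorRho : ∃ l : pullback (S.tensorR T) C.c ⟶ S.tensorObj T,
    ∀ {X : E} (z : X ⟶ S.Pairs T) (γ : X ⟶ C.C₁)
      (h : z ≫ pullback.snd S.R T.L ≫ T.R = γ ≫ C.c),
      pullback.lift (z ≫ S.tensorπ T) γ (by rw [← h, Category.assoc, tensorπ_R]) ≫ l =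
        pra T z γ h ≫ S.tensorπ T := by
  let f := pullback.fst (pullback.fst (S.tensorR T) C.c) (S.tensorπ T)
  let z₀ := pullback.snd (pullback.fst (S.tensorR T) C.c) (S.tensorπ T)
  have hf : f ≫ pullback.fst (S.tensorR T) C.c = z₀ ≫ S.tensorπ T := pullback.condition
  have h₀ : z₀ ≫ pullback.snd S.R T.L ≫ T.R =
      (f ≫ pullback.snd (S.tensorR T) C.c) ≫ C.c := by
    rw [Category.assoc, ← pullback.condition, reassoc_of% hf, tensorπ_R]
  obtain ⟨l, hl⟩ := exists_desc f (pra T z₀ _ h₀ ≫ S.tensorπ T) (by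
    intro W u v huv
    rw [← Category.assoc, ← Category.assoc, precomp_pra, precomp_pra,
      pra_congr _ rfl (show _ = v ≫ f ≫ _ by rw [reassoc_of% huv])]
    apply pra_π_eq
    rw [Category.assoc, Category.assoc, ← hf, reassoc_of% huv])
  refine ⟨l, fun {X} z γ h => ?_⟩
  let k := pullback.lift (f := pullback.fst (S.tensorR T) C.c) (g := S.tensorπ T)
    (pullback.lift (z ≫ S.tensorπ T) γ (by rw [← h, Category.assoc, tensorπ_R])) z
    (by rw [pullback.lift_fst])
  have k₁ : k ≫ f = pullback.lift (z ≫ S.tensorπ T) γ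
    (by rw [← h, Category.assoc, tensorπ_R]) := pullback.lift_fst ..
  have k₂ : k ≫ z₀ = z := pullback.lift_snd ..
  rw [← k₁, Category.assoc, hl, ← Category.assoc, precomp_pra]
  congr 1
  refine pra_congr _ k₂ ?_
  rw [reassoc_of% k₁, pullback.lift_snd]

/-- The left action on `(T ⊗ S)₀` induced from `λ_S`: the unique morphism with
`α · Q₀(s, t) = Q₀(α · s, t)`. -/
noncomputable def tensorLam : pullback A.d (S.tensorL T) ⟶ S.tensorObj T :=
  (S.exists_tensorLam T).choose

/-- The right action on `(T ⊗ S)₀` induced from `ρ_T`: the unique morphism with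
`Q₀(s, t) · γ = Q₀(s, t · γ)`. -/
noncomputable def tensorRho : pullback (S.tensorR T) C.c ⟶ S.tensorObj T :=
  (S.exists_tensorRho T).choose

section
variable {S T}

lemma lift_tensorLam (α : X ⟶ A.C₁) (z : X ⟶ S.Pairs T)
    (h : α ≫ A.d = z ≫ pullback.fst S.R T.L ≫ S.L) {y : X ⟶ S.tensorObj T}
    (hy : y = z ≫ S.tensorπ T) {w : α ≫ A.d = y ≫ S.tensorL T} :
    pullback.lift α y w ≫ S.tensorLam T = pla T α z h ≫ S.tensorπ T := by
  subst hy; exact (S.exists_tensorLam T).choose_spec α z h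

lemma lift_tensorRho (z : X ⟶ S.Pairs T) (γ : X ⟶ C.C₁)
    (h : z ≫ pullback.snd S.R T.L ≫ T.R = γ ≫ C.c) {y : X ⟶ S.tensorObj T}
    (hy : y = z ≫ S.tensorπ T) {w : y ≫ S.tensorR T = γ ≫ C.c} :
    pullback.lift y γ w ≫ S.tensorRho T = pra T z γ h ≫ S.tensorπ T := by
  subst hy; exact (S.exists_tensorRho T).choose_spec z γ h

lemma exists_pair (y : X ⟶ S.tensorObj T) : ∃ (X' : E) (p : X' ⟶ X) (z : X' ⟶ S.Pairs T),
    Epi p ∧ p ≫ y = z ≫ S.tensorπ T :=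
  ⟨_, pullback.fst y (S.tensorπ T), pullback.snd y (S.tensorπ T), inferInstance,
    pullback.condition⟩

lemma precomp_tensorLam (k : X ⟶ pullback A.d (S.tensorL T)) (z : X ⟶ S.Pairs T)
    (hz : k ≫ pullback.snd A.d (S.tensorL T) = z ≫ S.tensorπ T) :
    k ≫ S.tensorLam T = pla T (k ≫ pullback.fst A.d (S.tensorL T)) z
      (by rw [Category.assoc, pullback.condition, reassoc_of% hz, tensorπ_L]) ≫ S.tensorπ T := by
  rw [← lift_tensorLam (k ≫ pullback.fst A.d (S.tensorL T)) z
    (by rw [Category.assoc, pullback.condition, reassoc_of% hz, tensorπ_L]) hz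
    (w := by rw [Category.assoc, Category.assoc, pullback.condition])]
  congr 1
  ext <;> simp

lemma precomp_tensorRho (k : X ⟶ pullback (S.tensorR T) C.c) (z : X ⟶ S.Pairs T)
    (hz : k ≫ pullback.fst (S.tensorR T) C.c = z ≫ S.tensorπ T) :
    k ≫ S.tensorRho T = pra T z (k ≫ pullback.snd (S.tensorR T) C.c)
      (by rw [Category.assoc, ← pullback.condition, reassoc_of% hz, tensorπ_R]) ≫
        S.tensorπ T := by
  rw [← lift_tensorRho z (k ≫ pullback.snd (S.tensorR T) C.c)
    (by rw [Category.assoc, ← pullback.condition, reassoc_of% hz, tensorπ_R]) hz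
    (w := by rw [Category.assoc, Category.assoc, pullback.condition])]
  congr 1
  ext <;> simp

lemma comp_lift_assoc {K L M N : E} {f : K ⟶ M} {g : L ⟶ M} (p : Y ⟶ X) (a : X ⟶ K) (b : X ⟶ L)
    (w : a ≫ f = b ≫ g) (l : pullback f g ⟶ N) :
    p ≫ pullback.lift a b w ≫ l = pullback.lift (p ≫ a) (p ≫ b) (by simp [w]) ≫ l := by
  rw [← Category.assoc]
  congr 1
  ext <;> simp

end

/-- The composite `T ⊗ S` of internal distributors. -/
noncomputable def tensor : Distributor A C where
  S₀ := S.tensorObj T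
  L := S.tensorL T
  R := S.tensorR T
  lam := S.tensorLam T
  rho := S.tensorRho T
  lam_L := by
    obtain ⟨X', p, z, hp, hz⟩ := exists_pair (pullback.snd A.d (S.tensorL T))
    rw [← cancel_epi p, ← Category.assoc, precomp_tensorLam p z hz, Category.assoc, pla_π_L,
      Category.assoc]
  lam_R := by
    obtain ⟨X', p, z, hp, hz⟩ := exists_pair (pullback.snd A.d (S.tensorL T))
    rw [← cancel_epi p, ← Category.assoc, precomp_tensorLam p z hz, Category.assoc, tensorπ_R,
      ← Category.assoc, pla_snd, reassoc_of% hz, tensorπ_R, Category.assoc]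
  rho_L := by
    obtain ⟨X', p, z, hp, hz⟩ := exists_pair (pullback.fst (S.tensorR T) C.c)
    rw [← cancel_epi p, ← Category.assoc, precomp_tensorRho p z hz, Category.assoc, tensorπ_L,
      ← Category.assoc, pra_fst, reassoc_of% hz, tensorπ_L, Category.assoc]
  rho_R := by
    obtain ⟨X', p, z, hp, hz⟩ := exists_pair (pullback.fst (S.tensorR T) C.c)
    rw [← cancel_epi p, ← Category.assoc, precomp_tensorRho p z hz, Category.assoc, pra_π_R,
      Category.assoc]
  lam_unit := by
    rw [← cancel_epi (S.tensorπ T), comp_lift_assoc,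
      lift_tensorLam _ (𝟙 _) (by simp [A.e_d]) (by simp)]
    refine Eq.trans ?_ ((Category.id_comp _).trans (Category.comp_id _).symm)
    congr 1
    ext
    · rw [pla_fst]
      refine Eq.trans (la_congr _ ?_ rfl) (la_unit _ _ rfl)
      rw [← Category.assoc, tensorπ_L, Category.id_comp]
    · rw [pla_snd]
  rho_unit := by
    rw [← cancel_epi (S.tensorπ T), comp_lift_assoc,
      lift_tensorRho (𝟙 _) _ (by simp [C.e_c]) (by simp)]
    refine Eq.trans ?_ ((Category.id_comp _).trans (Category.comp_id _).symm)
    congr 1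
    ext
    · rw [pra_fst]
    · rw [pra_snd]
      refine Eq.trans (ra_congr _ rfl ?_) (ra_unit _ _ rfl)
      rw [← Category.assoc, tensorπ_R, Category.id_comp]
  lam_assoc α α' s h hs := by
    obtain ⟨X', p, z, hp, hz⟩ := exists_pair s
    have h₁ : (p ≫ α) ≫ A.d = z ≫ pullback.fst S.R T.L ≫ S.L := by
      rw [Category.assoc, hs, reassoc_of% hz, tensorπ_L]
    have h₂ : (p ≫ α) ≫ A.c = (p ≫ α') ≫ A.d := by rw [Category.assoc, Category.assoc, h]
    rw [← cancel_epi p, comp_lift_assoc, comp_lift_assoc,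
      lift_tensorLam _ z (by rw [IntGpd.precomp, IntGpd.comp_d, h₁]) hz,
      lift_tensorLam _ (pla T (p ≫ α) z h₁)
        (by rw [← Category.assoc, pla_fst, la_L, h₂])
        ((comp_lift_assoc ..).trans (lift_tensorLam _ z h₁ hz))]
    congr 1
    ext
    · rw [pla_fst, pla_fst, la_congr _ (IntGpd.precomp ..) rfl,
        la_la _ _ _ h₂ (by rw [h₁, Category.assoc])]
      exact la_congr _ rfl (pla_fst ..).symm
    · rw [pla_snd, pla_snd, pla_snd]
  rho_assoc s β' β h hs := by
    obtain ⟨X', p, z, hp, hz⟩ := exists_pair s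
    have h₁ : z ≫ pullback.snd S.R T.L ≫ T.R = (p ≫ β) ≫ C.c := by
      rw [Category.assoc, ← hs, reassoc_of% hz, tensorπ_R]
    have h₂ : (p ≫ β') ≫ C.c = (p ≫ β) ≫ C.d := by rw [Category.assoc, Category.assoc, h]
    rw [← cancel_epi p, comp_lift_assoc, comp_lift_assoc,
      lift_tensorRho z _ (by rw [IntGpd.precomp, IntGpd.comp_c, h₁]) hz,
      lift_tensorRho (pra T z (p ≫ β) h₁) _
        (by rw [← Category.assoc, pra_snd, ra_R, h₂])
        ((comp_lift_assoc ..).trans (lift_tensorRho z _ h₁ hz))]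
    congr 1
    ext
    · rw [pra_fst, pra_fst, pra_fst]
    · rw [pra_snd, pra_snd, ra_congr _ rfl (IntGpd.precomp ..),
        ra_ra _ _ _ h₂ (by rw [← h₁, Category.assoc])]
      exact ra_congr _ (pra_snd ..).symm rfl
  compat α s β h h' := by
    obtain ⟨X', p, z, hp, hz⟩ := exists_pair s
    have h₁ : (p ≫ α) ≫ A.d = z ≫ pullback.fst S.R T.L ≫ S.L := by
      rw [Category.assoc, h, reassoc_of% hz, tensorπ_L]
    have h₂ : z ≫ pullback.snd S.R T.L ≫ T.R = (p ≫ β) ≫ C.c := by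
      rw [Category.assoc, ← h', reassoc_of% hz, tensorπ_R]
    rw [← cancel_epi p]
    refine (comp_lift_assoc ..).trans (Eq.trans ?_ (comp_lift_assoc ..).symm)
    refine (lift_tensorRho (pla T (p ≫ α) z h₁) _
      (by rw [← Category.assoc, pla_snd, Category.assoc, h₂])
      ((comp_lift_assoc ..).trans (lift_tensorLam _ z h₁ hz))).trans (Eq.trans ?_
      (lift_tensorLam _ (pra T z (p ≫ β) h₂)
        (by rw [← Category.assoc (pra T z (p ≫ β) h₂), pra_fst, h₁, Category.assoc])
        ((comp_lift_assoc ..).trans (lift_tensorRho z _ h₂ hz))).symm)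
    congr 1
    ext
    · rw [pra_fst, pla_fst, pla_fst]
      exact la_congr _ rfl (pra_fst ..).symm
    · exact (pra_snd ..).trans ((ra_congr _ (pla_snd ..) rfl).trans
        ((pla_snd ..).trans (pra_snd ..)).symm)

end Distributor

end Exact

end InternalGpd

open InternalGpd

/-! An object of the composite span is a pair (s, t) with R s = L t. An arrow (s, t) → (s', t') is a
triple (α, β, γ) with α · s = s' · β and β · t = t' · γ. Under `Q` the middle component β is
forgotten: the triple (s', β, t) shows that (α · s, t) and (s', t' · γ) have the same class, so α ·
Q₀(s, t) = Q₀(s', t') · γ, which is an arrow of the groupoid of T ⊗ S.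

The heart of the matter is that `Q` is internally full (`isFull_tensorQ`). An arrow Q₀(s, t) →
Q₀(s', t') is a pair (α, γ) for which (α · s, t) and (s', t' · γ) have the same class.
Barr-exactness makes this equality witnessed, after a regular epimorphic cover, by a single triple.
Its two outer entries are forced to be s' and t, and its middle entry is the missing β. Thus the
arrow lifts locally.

Fullness together with Q₀ being a regular epimorphism gives everything else about `Q`. Objects with
the same image are locally joined by an arrow over an identity, and Q₁ is an epimorphism. Hence data
on the source descends along `Q`, which yields essential surjectivity (`IsFull.isEssSurj`). For
finality (`IsFull.isFinal`), a discrete fibration has only identities over identities with a given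
codomain, so its lifts descend too.

That `P` is a discrete fibration holds for every distributor (`isPullback_sq`): in a square α · s =
s' · β the entry s equals α⁻¹ · (s' · β), so α, β and s' determine the square freely. Uniqueness of
the factorization is then the usual orthogonality argument (`IsFinal.existsUnique_iso`). -/

namespace InternalGpd

/-! ### Internal fullness as local lifting of arrows -/

section Full

variable {E : Type u} [Category.{v} E] [BarrExact E] {G H : IntGpd E} {F : G ⟶ H}

/-- Arrows between objects in the image of an internally full functor lift locally. -/
lemma IsFull.exists_lift (hF : IsFull F) {X : E} (a b : X ⟶ G.C₀) (k : X ⟶ H.C₁)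
    (hd : k ≫ H.d = a ≫ F.F₀) (hc : k ≫ H.c = b ≫ F.F₀) :
    ∃ (X' : E) (p : X' ⟶ X) (g : X' ⟶ G.C₁),
      Epi p ∧ g ≫ G.d = p ≫ a ∧ g ≫ G.c = p ≫ b ∧ g ≫ F.F₁ = p ≫ k := by
  have : IsRegularEpi (fullComparison F) := hF
  -- The triple (a, b, k) is a generalized element of the joint pullback. Pulling the comparison
  -- back along it gives the cover as one projection and the local lift as the other; stability of
  -- regular epimorphisms makes the cover epic.
  let l : X ⟶ pullback (prod.map F.F₀ F.F₀) (prod.lift H.d H.c) :=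
    pullback.lift (prod.lift a b) k (by ext <;> simp [hd, hc])
  have w : pullback.fst l (fullComparison F) ≫ l =
      pullback.snd l (fullComparison F) ≫ fullComparison F := pullback.condition
  have w₁ := congrArg (fun t => t ≫ pullback.fst _ _ ≫ prod.fst) w
  have w₂ := congrArg (fun t => t ≫ pullback.fst _ _ ≫ prod.snd) w
  have w₃ := congrArg (fun t => t ≫ pullback.snd _ _) w
  simp only [l, fullComparison, Category.assoc, pullback.lift_fst_assoc, pullback.lift_snd,
    prod.lift_fst, prod.lift_snd] at w₁ w₂ w₃
  exact ⟨_, pullback.fst l (fullComparison F), pullback.snd l (fullComparison F), inferInstance,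
    w₁.symm, w₂.symm, w₃.symm⟩

/-- It suffices to lift the generic element, given by the projections of the joint pullback itself.
Its local lift exhibits the cover as a composite ending in `fullComparison F`, so the comparison is
a strong epimorphism, and in a regular category such a morphism is a regular epimorphism. -/
lemma isFull_of_exists_lift
    (h : ∀ {X : E} (a b : X ⟶ G.C₀) (k : X ⟶ H.C₁), k ≫ H.d = a ≫ F.F₀ → k ≫ H.c = b ≫ F.F₀ →
      ∃ (X' : E) (p : X' ⟶ X) (g : X' ⟶ G.C₁), IsRegularEpi p ∧ g ≫ G.d = p ≫ a ∧
        g ≫ G.c = p ≫ b ∧ g ≫ F.F₁ = p ≫ k) : IsFull F := by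
  have w : pullback.fst (prod.map F.F₀ F.F₀) (prod.lift H.d H.c) ≫ prod.map F.F₀ F.F₀ =
    pullback.snd _ _ ≫ prod.lift H.d H.c := pullback.condition
  have w₁ := congrArg (fun t => t ≫ prod.fst) w
  have w₂ := congrArg (fun t => t ≫ prod.snd) w
  simp only [Category.assoc, prod.map_fst, prod.map_snd, prod.lift_fst, prod.lift_snd] at w₁ w₂
  obtain ⟨X', p, g, hp, h₁, h₂, h₃⟩ := h
    (pullback.fst (prod.map F.F₀ F.F₀) (prod.lift H.d H.c) ≫ prod.fst)
    (pullback.fst (prod.map F.F₀ F.F₀) (prod.lift H.d H.c) ≫ prod.snd)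
    (pullback.snd (prod.map F.F₀ F.F₀) (prod.lift H.d H.c)) (by simp [w₁]) (by simp [w₂])
  have fac : g ≫ fullComparison F = p := by
    apply pullback.hom_ext
    · ext <;> simp only [fullComparison, Category.assoc, pullback.lift_fst, prod.lift_fst,
        prod.lift_snd, h₁, h₂]
    · simp [fullComparison, pullback.lift_snd, h₃]
  have : StrongEpi (g ≫ fullComparison F) := by rw [fac]; infer_instance
  have : StrongEpi (fullComparison F) := strongEpi_of_strongEpi g _
  have : ExtremalEpi (fullComparison F) := inferInstance
  exact Regular.isRegularEpi_of_extremalEpi _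

/-- Objects identified by an internally full functor are locally connected by an arrow over the
identity. -/
lemma IsFull.exists_lift_id (hF : IsFull F) {X : E} (a b : X ⟶ G.C₀)
    (hab : a ≫ F.F₀ = b ≫ F.F₀) :
    ∃ (X' : E) (p : X' ⟶ X) (g : X' ⟶ G.C₁),
      Epi p ∧ g ≫ G.d = p ≫ a ∧ g ≫ G.c = p ≫ b ∧ g ≫ F.F₁ = p ≫ a ≫ F.F₀ ≫ H.e := by
  simpa using hF.exists_lift a b (a ≫ F.F₀ ≫ H.e) (by simp [H.e_d]) (by simp [H.e_c, hab])

/-- If `F` is internally full and `F₀` is a regular epimorphism, arrows lift locally. -/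
lemma IsFull.exists_lift_arrow (hF : IsFull F) [IsRegularEpi F.F₀] {X : E} (k : X ⟶ H.C₁) :
    ∃ (X' : E) (p : X' ⟶ X) (g : X' ⟶ G.C₁), Epi p ∧ g ≫ F.F₁ = p ≫ k := by
  -- Two successive covers are needed: over the first, the domain of `k` comes from an object of
  -- `G`; over the second, its codomain does as well.
  let p₁ := pullback.fst (k ≫ H.d) F.F₀
  let p₂ := pullback.fst (p₁ ≫ k ≫ H.c) F.F₀
  obtain ⟨X', p, g, hp, -, -, h⟩ := hF.exists_lift (p₂ ≫ pullback.snd (k ≫ H.d) F.F₀)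
    (pullback.snd (p₁ ≫ k ≫ H.c) F.F₀) (p₂ ≫ p₁ ≫ k)
    (by simp [p₁, pullback.condition]) (by simp [p₂, ← pullback.condition])
  exact ⟨X', p ≫ p₂ ≫ p₁, g, inferInstance, by simpa using h⟩

/-- Lifting the generic arrow `𝟙 H.C₁` locally factors an epimorphic cover through `F.F₁`. -/
lemma IsFull.epi_F₁ (hF : IsFull F) [IsRegularEpi F.F₀] : Epi F.F₁ := by
  obtain ⟨X', p, g, hp, h⟩ := hF.exists_lift_arrow (𝟙 H.C₁)
  rw [Category.comp_id] at h
  have : Epi (g ≫ F.F₁) := by rwa [h]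
  exact epi_of_epi g _

/-! ### Connected components and essential surjectivity -/

/-- The quotient morphism onto the object of connected components. -/
noncomputable def Pi0.π (G : IntGpd E) : G.C₀ ⟶ Pi0 G := coequalizer.π G.d G.c

instance (G : IntGpd E) : Epi (Pi0.π G) := inferInstanceAs (Epi (coequalizer.π G.d G.c))

lemma Pi0.condition (G : IntGpd E) : G.d ≫ Pi0.π G = G.c ≫ Pi0.π G := coequalizer.condition _ _

lemma Pi0.π_map (F : G ⟶ H) : Pi0.π G ≫ Pi0.map F = F.F₀ ≫ Pi0.π H := coequalizer.π_desc _ _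

lemma Pi0.exists_desc {X : E} (k : G.C₀ ⟶ X) (hk : G.d ≫ k = G.c ≫ k) :
    ∃ l : Pi0 G ⟶ X, Pi0.π G ≫ l = k :=
  ⟨coequalizer.desc k hk, coequalizer.π_desc _ _⟩

/-- An internally full functor which is a regular epimorphism on objects is internally essentially
surjective. -/
lemma IsFull.isEssSurj (hF : IsFull F) [IsRegularEpi F.F₀] : IsEssSurj F := by
  have : Epi F.F₁ := hF.epi_F₁
  -- The inverse sends the component of an object F x to the component of x. This does not depend on
  -- x, since two objects with the same image are locally connected.
  obtain ⟨l, hl⟩ := InternalGpd.exists_desc F.F₀ (Pi0.π G) (by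
    intro W a b hab
    obtain ⟨X', p, g, hp, h₁, h₂, -⟩ := hF.exists_lift_id a b hab
    rw [← cancel_epi p, ← reassoc_of% h₁, ← reassoc_of% h₂, Pi0.condition])
  -- Constancy along the arrows of `H` may be tested on images of arrows of `G`, because `F.F₁` is
  -- an epimorphism.
  obtain ⟨inv, hinv⟩ := Pi0.exists_desc (G := H) l (by
    rw [← cancel_epi F.F₁, reassoc_of% F.map_d, reassoc_of% F.map_c, hl, Pi0.condition])
  refine ⟨inv, ?_, ?_⟩
  · rw [← cancel_epi (Pi0.π G), reassoc_of% Pi0.π_map F, hinv, hl, Category.comp_id]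
  · rw [← cancel_epi (Pi0.π H), ← cancel_epi F.F₀, reassoc_of% hinv, reassoc_of% hl, Pi0.π_map,
      Category.comp_id]

/-! ### Lifting against discrete fibrations, and finality -/

lemma IsDiscreteFibration.hom_ext {p : G ⟶ H} (hp : IsDiscreteFibration p) {X : E}
    {f g : X ⟶ G.C₁} (h₁ : f ≫ p.F₁ = g ≫ p.F₁) (h₂ : f ≫ G.c = g ≫ G.c) : f = g :=
  IsPullback.hom_ext hp h₁ h₂

/-- A lift of an internal functor along a discrete fibration on objects and on arrows which is
compatible with domains and codomains is an internal functor. -/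
def IsDiscreteFibration.liftFunctor {K : IntGpd E} {p : G ⟶ H} (hp : IsDiscreteFibration p)
    (v : K ⟶ H) (w₀ : K.C₀ ⟶ G.C₀) (w₁ : K.C₁ ⟶ G.C₁) (h₀ : w₀ ≫ p.F₀ = v.F₀)
    (h₁ : w₁ ≫ p.F₁ = v.F₁) (hd : w₁ ≫ G.d = K.d ≫ w₀) (hc : w₁ ≫ G.c = K.c ≫ w₀) : K ⟶ G where
  F₀ := w₀
  F₁ := w₁
  map_d := hd
  map_c := hc
  -- Preservation of identities and of composition is automatic: in each case the two arrows to be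
  -- compared have the same image under `p`, because `v` and `p` are functors, and the same
  -- codomain.
  map_e := hp.hom_ext
    (by rw [Category.assoc, Category.assoc, h₁, p.map_e, v.map_e, reassoc_of% h₀])
    (by rw [Category.assoc, Category.assoc, hc, G.e_c, reassoc_of% K.e_c, Category.comp_id])
  map_m := hp.hom_ext
    (by
      rw [Category.assoc, h₁, v.map_m, p.map_comp]
      apply IntGpd.comp_congr <;> simp [h₁])
    (by
      refine Eq.trans ?_ (IntGpd.comp_c _ _ _).symm
      rw [Category.assoc, hc, reassoc_of% K.m_c, Category.assoc, hc])

/-- An internally full functor which is a regular epimorphism on objects is final. -/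
lemma IsFull.isFinal (hF : IsFull F) [IsRegularEpi F.F₀] : IsFinal F := by
  intro X Y p hp u v sq
  have : Epi F.F₁ := hF.epi_F₁
  have sq₀ : u.F₀ ≫ p.F₀ = F.F₀ ≫ v.F₀ := congrArg IntFunctor.F₀ sq
  have sq₁ : u.F₁ ≫ p.F₁ = F.F₁ ≫ v.F₁ := congrArg IntFunctor.F₁ sq
  -- If a and b have the same image, choose locally an arrow g : a → b over an identity. Then u g
  -- lies over an identity of `Y` and has codomain u b, so it must be the identity of u b. Comparing
  -- domains gives u a = u b.
  obtain ⟨w₀, hw₀⟩ := exists_desc F.F₀ u.F₀ (by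
    intro W a b hab
    obtain ⟨X', q, g, hq, h₁, h₂, h₃⟩ := hF.exists_lift_id a b hab
    have hg : g ≫ u.F₁ = (q ≫ b) ≫ u.F₀ ≫ X.e := by
      refine hp.hom_ext ?_ ?_
      · simp only [Category.assoc, p.map_e, reassoc_of% sq₀, sq₁, reassoc_of% h₃, v.map_e,
          reassoc_of% hab]
      · simp only [Category.assoc, u.map_c, reassoc_of% h₂, X.e_c, Category.comp_id]
    have hd := congrArg (fun t => t ≫ X.d) hg
    simp only [Category.assoc, u.map_d, reassoc_of% h₁, X.e_d, Category.comp_id] at hd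
    rwa [cancel_epi] at hd)
  have hwp₀ : w₀ ≫ p.F₀ = v.F₀ := by rw [← cancel_epi F.F₀, reassoc_of% hw₀, sq₀]
  -- On arrows there is no choice: the value is the unique arrow over `v.F₁` with the codomain
  -- prescribed by `w₀`. Its domain is the expected one because this can be checked after the
  -- epimorphism `F.F₁`.
  obtain ⟨w₁, hwp₁, hwc⟩ : ∃ w₁ : H.C₁ ⟶ X.C₁, w₁ ≫ p.F₁ = v.F₁ ∧ w₁ ≫ X.c = H.c ≫ w₀ := by
    have w : v.F₁ ≫ Y.c = (H.c ≫ w₀) ≫ p.F₀ := by rw [Category.assoc, hwp₀, v.map_c]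
    exact ⟨IsPullback.lift hp v.F₁ (H.c ≫ w₀) w, IsPullback.lift_fst hp _ _ w,
      IsPullback.lift_snd hp _ _ w⟩
  have hw₁ : F.F₁ ≫ w₁ = u.F₁ := hp.hom_ext (by rw [Category.assoc, hwp₁, sq₁])
    (by rw [Category.assoc, hwc, reassoc_of% F.map_c, hw₀, u.map_c])
  have hwd : w₁ ≫ X.d = H.d ≫ w₀ := by
    rw [← cancel_epi F.F₁, reassoc_of% hw₁, u.map_d, reassoc_of% F.map_d, hw₀]
  let w : H ⟶ X := hp.liftFunctor v w₀ w₁ hwp₀ hwp₁ hwd hwc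
  refine ⟨w, ⟨IntFunctor.hom_ext hw₀ hw₁, IntFunctor.hom_ext hwp₀ hwp₁⟩, ?_⟩
  rintro w' ⟨h, -⟩
  apply IntFunctor.hom_ext
  · rw [← cancel_epi F.F₀]
    exact (congrArg IntFunctor.F₀ h).trans hw₀.symm
  · rw [← cancel_epi F.F₁]
    exact (congrArg IntFunctor.F₁ h).trans hw₁.symm

/-- Factorizations into a final functor followed by a discrete fibration are unique up to unique
isomorphism. -/
lemma IsFinal.existsUnique_iso {X Y Z Z' : IntGpd E} {F : X ⟶ Z} {K : Z ⟶ Y} {F' : X ⟶ Z'}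
    {K' : Z' ⟶ Y} (hF : IsFinal F) (hK : IsDiscreteFibration K) (hF' : IsFinal F')
    (hK' : IsDiscreteFibration K') (h : F ≫ K = F' ≫ K') :
    ∃! i : Z ≅ Z', F ≫ i.hom = F' ∧ i.hom ≫ K' = K := by
  obtain ⟨f, ⟨hf₁, hf₂⟩, huniq⟩ := hF K' hK' F' K h.symm
  obtain ⟨g, ⟨hg₁, hg₂⟩, -⟩ := hF' K hK F K' h
  -- Both this composite and the identity fill the square from `F` to `K` with sides `F` and `K`, so
  -- they coincide; the other composite is treated alike.
  have hfg : f ≫ g = 𝟙 Z := (hF K hK F K rfl).unique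
    ⟨by rw [reassoc_of% hf₁, hg₁], by rw [Category.assoc, hg₂, hf₂]⟩
    ⟨Category.comp_id _, Category.id_comp _⟩
  have hgf : g ≫ f = 𝟙 Z' := (hF' K' hK' F' K' rfl).unique
    ⟨by rw [reassoc_of% hg₁, hf₁], by rw [Category.assoc, hf₂, hg₂]⟩
    ⟨Category.comp_id _, Category.id_comp _⟩
  exact ⟨⟨f, g, hfg, hgf⟩, ⟨hf₁, hf₂⟩, fun i hi => Iso.ext (huniq i.hom hi)⟩

end Full

namespace Distributor

section

/-! ### The projections of a distributor form a discrete fibration -/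

variable {E : Type u} [Category.{v} E] [HasFiniteLimits E] {A B : IntGpd E} {S : Distributor A B}
  {X : E}

lemma la_inv_la (α : X ⟶ A.C₁) (s : X ⟶ S.S₀) (h : α ≫ A.d = s ≫ S.L) :
    S.la (α ≫ A.τ) (S.la α s h) (by rw [la_L, Category.assoc, A.τ_d]) = s := by
  rw [← la_la _ _ _ (by rw [Category.assoc, A.τ_d]), la_congr _ (IntGpd.comp_inv _) rfl]
  simpa using la_unit s (α ≫ A.d) h.symm

lemma la_la_inv (α : X ⟶ A.C₁) (s : X ⟶ S.S₀) (h : (α ≫ A.τ) ≫ A.d = s ≫ S.L) :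
    S.la α (S.la (α ≫ A.τ) s h) (by rw [la_L, Category.assoc, A.τ_c]) = s := by
  rw [← la_la _ _ _ (by rw [Category.assoc, A.τ_c]), la_congr _ (IntGpd.inv_comp _) rfl]
  simpa using la_unit s (α ≫ A.c) (by rw [← h, Category.assoc, A.τ_d])

lemma precomp_sq_comm (f : X ⟶ S.Sq) :
    S.la (f ≫ S.sqα) (f ≫ S.sqs) (by simp [sqα_d]) =
      S.ra (f ≫ S.sqs') (f ≫ S.sqβ) (by simp [sqβ_c]) := by
  rw [← precomp_la _ _ _ S.sqα_d, sq_comm, precomp_ra]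

/-- The remaining entry is redundant: since α is invertible, s = α⁻¹ · (s' · β). -/
lemma sqs_ext {f g : X ⟶ S.Sq} (hα : f ≫ S.sqα = g ≫ S.sqα) (hs' : f ≫ S.sqs' = g ≫ S.sqs')
    (hβ : f ≫ S.sqβ = g ≫ S.sqβ) : f = g := by
  refine sq_ext hα ?_ hs' hβ
  rw [← la_inv_la (f ≫ S.sqα) (f ≫ S.sqs) (by simp [sqα_d]),
    ← la_inv_la (g ≫ S.sqα) (g ≫ S.sqs) (by simp [sqα_d])]
  refine la_congr _ (by rw [hα]) ?_
  rw [precomp_sq_comm, precomp_sq_comm]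
  exact ra_congr _ hs' hβ

/-- Arrows of `A × B` lift along the projections to arrows with prescribed codomain. -/
lemma exists_sq (α : X ⟶ A.C₁) (β : X ⟶ B.C₁) (s' : X ⟶ S.S₀) (hα : α ≫ A.c = s' ≫ S.L)
    (hβ : s' ≫ S.R = β ≫ B.c) :
    ∃ f : X ⟶ S.Sq, f ≫ S.sqα = α ∧ f ≫ S.sqβ = β ∧ f ≫ S.sqs' = s' := by
  have h : (α ≫ A.τ) ≫ A.d = S.ra s' β hβ ≫ S.L := by rw [Category.assoc, A.τ_d, hα, ra_L]
  -- The domain is forced to be α⁻¹ · (s' · β).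
  exact ⟨S.sqMk α (S.la (α ≫ A.τ) (S.ra s' β hβ) h) s' β
    (by rw [la_L, Category.assoc, A.τ_c]) hβ (la_la_inv _ _ h), by simp, by simp, by simp⟩

/-- Existence of the mediating morphism is `exists_sq` and uniqueness is `sqs_ext`. The square is
the codomain square of `S.leg`, written out in components. -/
lemma isPullback_sq (S : Distributor A B) :
    IsPullback (prod.lift S.sqα S.sqβ) S.sqs' (prod.map A.c B.c) (prod.lift S.L S.R) := by
  have lift (t : PullbackCone (prod.map A.c B.c) (prod.lift S.L S.R)) :
      ∃ g : t.pt ⟶ S.Sq, g ≫ prod.lift S.sqα S.sqβ = t.fst ∧ g ≫ S.sqs' = t.snd := by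
    have w₁ := congrArg (fun k => k ≫ prod.fst) t.condition
    have w₂ := congrArg (fun k => k ≫ prod.snd) t.condition
    simp only [Category.assoc, prod.map_fst, prod.map_snd, prod.lift_fst, prod.lift_snd] at w₁ w₂
    obtain ⟨g, h₁, h₂, h₃⟩ := exists_sq (S := S) (t.fst ≫ prod.fst) (t.fst ≫ prod.snd) t.snd
      (by rw [Category.assoc, w₁]) (by rw [Category.assoc, w₂])
    exact ⟨g, by ext <;> simp only [Category.assoc, prod.lift_fst, prod.lift_snd, h₁, h₂], h₃⟩
  choose l hl₁ hl₂ using lift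
  have w : prod.lift S.sqα S.sqβ ≫ prod.map A.c B.c = S.sqs' ≫ prod.lift S.L S.R := by
    ext <;> simp [sqα_c, sqβ_c]
  refine ⟨⟨w⟩, ⟨PullbackCone.IsLimit.mk _ l hl₁ hl₂ fun t m h₁ h₂ => ?_⟩⟩
  have h := h₁.trans (hl₁ t).symm
  have hα := congrArg (fun k => k ≫ prod.fst) h
  have hβ := congrArg (fun k => k ≫ prod.snd) h
  simp only [Category.assoc, prod.lift_fst, prod.lift_snd] at hα hβ
  exact sqs_ext hα (h₂.trans (hl₂ t).symm) hβ

/-- The two projections of the groupoid of a distributor form a discrete fibration. -/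
lemma isDiscreteFibration_leg (S : Distributor A B) : IsDiscreteFibration S.leg :=
  S.isPullback_sq

end

/-! ### Arrows of the composite span, in components -/

section

variable {E : Type u} [Category.{v} E] [BarrExact E] {A B C : IntGpd E}
  (S : Distributor A B) (T : Distributor B C) {X : E}

/-- The `S`-component of an arrow of the composite span. -/
noncomputable def spanCompS : (S.spanComp T).C₁ ⟶ S.Sq := pullback.fst S.sqβ T.sqα

/-- The `T`-component of an arrow of the composite span. -/
noncomputable def spanCompT : (S.spanComp T).C₁ ⟶ T.Sq := pullback.snd S.sqβ T.sqα

lemma spanComp_condition : S.spanCompS T ≫ S.sqβ = S.spanCompT T ≫ T.sqα := pullback.condition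

/-- The generalized arrow of the composite span with given components. -/
noncomputable def spanCompMk (f : X ⟶ S.Sq) (g : X ⟶ T.Sq) (w : f ≫ S.sqβ = g ≫ T.sqα) :
    X ⟶ (S.spanComp T).C₁ :=
  pullback.lift (f := S.sqβ) (g := T.sqα) f g w

lemma spanCompMk_S (f : X ⟶ S.Sq) (g : X ⟶ T.Sq) (w : f ≫ S.sqβ = g ≫ T.sqα) :
    S.spanCompMk T f g w ≫ S.spanCompS T = f := pullback.lift_fst ..

lemma spanCompMk_T (f : X ⟶ S.Sq) (g : X ⟶ T.Sq) (w : f ≫ S.sqβ = g ≫ T.sqα) :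
    S.spanCompMk T f g w ≫ S.spanCompT T = g := pullback.lift_snd ..

/-- The domain of an arrow of the composite span, as a pair. -/
noncomputable def spanCompD : (S.spanComp T).C₁ ⟶ S.Pairs T := (S.spanComp T).d

/-- The codomain of an arrow of the composite span, as a pair. -/
noncomputable def spanCompC : (S.spanComp T).C₁ ⟶ S.Pairs T := (S.spanComp T).c

@[simp] lemma spanCompD_fst :
    S.spanCompD T ≫ pullback.fst S.R T.L = S.spanCompS T ≫ S.sqs := pullback.lift_fst ..

@[simp] lemma spanCompD_snd :
    S.spanCompD T ≫ pullback.snd S.R T.L = S.spanCompT T ≫ T.sqs := pullback.lift_snd ..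

@[simp] lemma spanCompC_fst :
    S.spanCompC T ≫ pullback.fst S.R T.L = S.spanCompS T ≫ S.sqs' := pullback.lift_fst ..

@[simp] lemma spanCompC_snd :
    S.spanCompC T ≫ pullback.snd S.R T.L = S.spanCompT T ≫ T.sqs' := pullback.lift_snd ..

/-- The action on a class is computed on any representative pair. The element `y` is kept separate
from `z ≫ S.tensorπ T` because in the fullness argument it is an endpoint of a given arrow, equal to
that class only by hypothesis. -/
lemma tensor_la (α : X ⟶ A.C₁) (z : X ⟶ S.Pairs T)
    (h : α ≫ A.d = z ≫ pullback.fst S.R T.L ≫ S.L) {y : X ⟶ (S.tensor T).S₀}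
    (hy : y = z ≫ S.tensorπ T) (w : α ≫ A.d = y ≫ (S.tensor T).L) :
    (S.tensor T).la α y w = pla T α z h ≫ S.tensorπ T :=
  lift_tensorLam α z h hy

lemma tensor_ra (z : X ⟶ S.Pairs T) (γ : X ⟶ C.C₁)
    (h : z ≫ pullback.snd S.R T.L ≫ T.R = γ ≫ C.c) {y : X ⟶ (S.tensor T).S₀}
    (hy : y = z ≫ S.tensorπ T) (w : y ≫ (S.tensor T).R = γ ≫ C.c) :
    (S.tensor T).ra y γ w = pra T z γ h ≫ S.tensorπ T :=
  lift_tensorRho z γ h hy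

lemma spanCompD_L : (S.spanCompS T ≫ S.sqα) ≫ A.d =
    S.spanCompD T ≫ pullback.fst S.R T.L ≫ S.L := by
  rw [Category.assoc, sqα_d, reassoc_of% S.spanCompD_fst T]

lemma spanCompC_R : S.spanCompC T ≫ pullback.snd S.R T.L ≫ T.R =
    (S.spanCompT T ≫ T.sqβ) ≫ C.c := by
  rw [Category.assoc, ← sqβ_c, reassoc_of% S.spanCompC_snd T]

/-- For an arrow (α, β, γ) from (s, t) to (s', t'), the triple (s', β, t) is sent by `hd` to (s' ·
β, t) = (α · s, t) and by `hc` to (s', β · t) = (s', t' · γ). The coequalizer identifies the two,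
which is the equation making `tensorQ₁` well defined. -/
lemma pla_spanCompD_π :
    pla T (S.spanCompS T ≫ S.sqα) (S.spanCompD T) (S.spanCompD_L T) ≫ S.tensorπ T =
      pra T (S.spanCompC T) (S.spanCompT T ≫ T.sqβ) (S.spanCompC_R T) ≫ S.tensorπ T := by
  let h : (S.spanComp T).C₁ ⟶ S.Triples T :=
    S.trMk T (S.spanCompS T ≫ S.sqs') (S.spanCompS T ≫ S.sqβ) (S.spanCompT T ≫ T.sqs)
      (by rw [Category.assoc, sqβ_c, Category.assoc])
      (by rw [spanComp_condition, Category.assoc, sqα_d, Category.assoc])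
  have h₁ : h ≫ S.hd T =
      pla T (S.spanCompS T ≫ S.sqα) (S.spanCompD T) (S.spanCompD_L T) := by
    ext
    · rw [hd_fst', pla_fst, ra_congr _ (trMk_s ..) (trMk_β ..), ← precomp_sq_comm]
      exact la_congr _ rfl (S.spanCompD_fst T).symm
    · rw [Category.assoc, hd_snd, pla_snd, trMk_t, spanCompD_snd]
  have h₂ : h ≫ S.hc T =
      pra T (S.spanCompC T) (S.spanCompT T ≫ T.sqβ) (S.spanCompC_R T) := by
    ext
    · rw [Category.assoc, hc_fst, pra_fst, trMk_s, spanCompC_fst]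
    · rw [hc_snd', pra_snd, la_congr _ ((trMk_β ..).trans (S.spanComp_condition T)) (trMk_t ..),
        precomp_sq_comm]
      exact ra_congr _ (S.spanCompC_snd T).symm rfl
  rw [← h₁, ← h₂, Category.assoc, Category.assoc, hd_π]

/-! ### The comparison functor and its fullness -/

/-- The arrow component of the comparison functor from the composite span to the groupoid of the
composite distributor. -/
noncomputable def tensorQ₁ : (S.spanComp T).C₁ ⟶ (S.tensor T).Sq :=
  (S.tensor T).sqMk (S.spanCompS T ≫ S.sqα) (S.spanCompD T ≫ S.tensorπ T)
    (S.spanCompC T ≫ S.tensorπ T) (S.spanCompT T ≫ T.sqβ)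
    ((S.spanCompD_L T).trans (by
      rw [← tensorπ_L]
      exact (Category.assoc _ _ _).symm))
    (Eq.trans (by
      rw [← tensorπ_R]
      exact Category.assoc _ _ _) (S.spanCompC_R T))
    ((tensor_la S T _ _ (S.spanCompD_L T) rfl _).trans ((S.pla_spanCompD_π T).trans
      (tensor_ra S T _ _ (S.spanCompC_R T) rfl _).symm))

@[simp] lemma tensorQ₁_α : S.tensorQ₁ T ≫ (S.tensor T).sqα = S.spanCompS T ≫ S.sqα := sqMk_α ..

@[simp] lemma tensorQ₁_s : S.tensorQ₁ T ≫ (S.tensor T).sqs = S.spanCompD T ≫ S.tensorπ T :=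
  sqMk_s ..

@[simp] lemma tensorQ₁_s' : S.tensorQ₁ T ≫ (S.tensor T).sqs' = S.spanCompC T ≫ S.tensorπ T :=
  sqMk_s' ..

@[simp] lemma tensorQ₁_β : S.tensorQ₁ T ≫ (S.tensor T).sqβ = S.spanCompT T ≫ T.sqβ := sqMk_β ..

/-- `Q₁` is the arrow part of the factorization of the leg of the composite span. -/
lemma tensorQ₁_leg : S.tensorQ₁ T ≫ (S.tensor T).leg.F₁ = (S.spanCompLeg T).F₁ := by
  apply Limits.prod.hom_ext
  · refine (Category.assoc _ _ _).trans ((congrArg (fun t => S.tensorQ₁ T ≫ t)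
      (Limits.prod.lift_fst _ _)).trans ((S.tensorQ₁_α T).trans ?_))
    exact (Limits.prod.lift_fst _ _).symm
  · refine (Category.assoc _ _ _).trans ((congrArg (fun t => S.tensorQ₁ T ≫ t)
      (Limits.prod.lift_snd _ _)).trans ((S.tensorQ₁_β T).trans ?_))
    exact (Limits.prod.lift_snd _ _).symm

lemma tensorπ_leg : S.tensorπ T ≫ (S.tensor T).leg.F₀ = (S.spanCompLeg T).F₀ := by
  apply Limits.prod.hom_ext
  · refine (Category.assoc _ _ _).trans ((congrArg (fun t => S.tensorπ T ≫ t)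
      (Limits.prod.lift_fst _ _)).trans ((S.tensorπ_L T).trans ?_))
    exact (Limits.prod.lift_fst _ _).symm
  · refine (Category.assoc _ _ _).trans ((congrArg (fun t => S.tensorπ T ≫ t)
      (Limits.prod.lift_snd _ _)).trans ((S.tensorπ_R T).trans ?_))
    exact (Limits.prod.lift_snd _ _).symm

/-- The comparison functor from the composite span to the groupoid of the composite distributor. -/
noncomputable def tensorQ : S.spanComp T ⟶ (S.tensor T).total :=
  (S.tensor T).isDiscreteFibration_leg.liftFunctor (S.spanCompLeg T) (S.tensorπ T)
    (S.tensorQ₁ T) (S.tensorπ_leg T) (S.tensorQ₁_leg T) (S.tensorQ₁_s T) (S.tensorQ₁_s' T)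

instance : IsRegularEpi (S.tensorQ T).F₀ := inferInstanceAs (IsRegularEpi (S.tensorπ T))

/-- The comparison functor is internally full. -/
lemma isFull_tensorQ : IsFull (S.tensorQ T) := by
  apply isFull_of_exists_lift
  intro X (a : X ⟶ S.Pairs T) (b : X ⟶ S.Pairs T) (k : X ⟶ (S.tensor T).Sq)
    (hd : k ≫ (S.tensor T).sqs = a ≫ S.tensorπ T) (hc : k ≫ (S.tensor T).sqs' = b ≫ S.tensorπ T)
  have ha : (k ≫ (S.tensor T).sqα) ≫ A.d = a ≫ pullback.fst S.R T.L ≫ S.L := by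
    rw [Category.assoc, sqα_d, reassoc_of% hd]
    exact (Category.assoc _ _ _).trans (congrArg (fun t => a ≫ t) (S.tensorπ_L T))
  have hb : b ≫ pullback.snd S.R T.L ≫ T.R = (k ≫ (S.tensor T).sqβ) ≫ C.c := by
    rw [Category.assoc, ← sqβ_c, reassoc_of% hc]
    exact ((Category.assoc _ _ _).trans (congrArg (fun t => b ≫ t) (S.tensorπ_R T))).symm
  -- The equation carried by the square `k`, read on the representatives `a` and `b`: the pairs α ·
  -- a and b · γ have the same class.
  have hab : pla T _ a ha ≫ S.tensorπ T = pra T b _ hb ≫ S.tensorπ T :=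
    (tensor_la S T _ a ha hd (by simp [sqα_d])).symm.trans ((precomp_sq_comm k).trans
      (tensor_ra S T b _ hb hc (by simp [sqβ_c])))
  -- Exactness enters here: a single triple, over a regular epimorphic cover, relates the two pairs.
  -- Comparing components shows that it is (s_b, β, t_a) with α · s_a = s_b · β and β · t_a = t_b ·
  -- γ.
  obtain ⟨X', p, h, hp, h₁, h₂⟩ := exists_triple _ _ hab
  have h₁f := congrArg (fun t => t ≫ pullback.fst S.R T.L) h₁
  have h₁s := congrArg (fun t => t ≫ pullback.snd S.R T.L) h₁
  have h₂f := congrArg (fun t => t ≫ pullback.fst S.R T.L) h₂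
  have h₂s := congrArg (fun t => t ≫ pullback.snd S.R T.L) h₂
  simp only [hd_fst', pla_fst, precomp_pla] at h₁f
  simp only [Category.assoc, hd_snd, pla_snd] at h₁s
  simp only [Category.assoc, hc_fst, pra_fst] at h₂f
  simp only [hc_snd', pra_snd, precomp_pra] at h₂s
  -- These two equations are squares of `S` and of `T` sharing the entry β, hence together an arrow
  -- of the composite span from `a` to `b`.
  let σ : X' ⟶ S.Sq := S.sqMk (p ≫ k ≫ (S.tensor T).sqα) ((p ≫ a) ≫ pullback.fst S.R T.L)
    (p ≫ b ≫ pullback.fst S.R T.L) (h ≫ S.trβ T)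
    (by simpa using congrArg (fun t => p ≫ t) ha)
    (by rw [← h₂f, Category.assoc, trs_R, Category.assoc])
    (h₁f.symm.trans (ra_congr _ h₂f rfl))
  let θ : X' ⟶ T.Sq := T.sqMk (h ≫ S.trβ T) (p ≫ a ≫ pullback.snd S.R T.L)
    ((p ≫ b) ≫ pullback.snd S.R T.L) (p ≫ k ≫ (S.tensor T).sqβ)
    (by rw [← h₁s, Category.assoc, trt_L, Category.assoc])
    (by simpa using congrArg (fun t => p ≫ t) hb)
    ((la_congr _ rfl h₁s.symm).trans h₂s)
  let g := S.spanCompMk T σ θ (by simp [σ, θ])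
  have gS : g ≫ S.spanCompS T = σ := S.spanCompMk_S T ..
  have gT : g ≫ S.spanCompT T = θ := S.spanCompMk_T T ..
  have gd : g ≫ S.spanCompD T = p ≫ a := by
    ext
    · rw [Category.assoc, spanCompD_fst, reassoc_of% gS, sqMk_s, Category.assoc]
    · rw [Category.assoc, spanCompD_snd, reassoc_of% gT, sqMk_s, Category.assoc]
  have gc : g ≫ S.spanCompC T = p ≫ b := by
    ext
    · rw [Category.assoc, spanCompC_fst, reassoc_of% gS, sqMk_s', Category.assoc]
    · rw [Category.assoc, spanCompC_snd, reassoc_of% gT, sqMk_s', Category.assoc]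
  refine ⟨X', p, g, hp, gd, gc, ?_⟩
  change g ≫ S.tensorQ₁ T = p ≫ k
  apply sq_ext
  · rw [Category.assoc, tensorQ₁_α, reassoc_of% gS, sqMk_α, Category.assoc]
  · have e : g ≫ S.spanCompD T ≫ S.tensorπ T = p ≫ a ≫ S.tensorπ T := by
      rw [reassoc_of% gd]
    rw [Category.assoc, tensorQ₁_s, Category.assoc, hd]
    exact e
  · have e : g ≫ S.spanCompC T ≫ S.tensorπ T = p ≫ b ≫ S.tensorπ T := by
      rw [reassoc_of% gc]
    rw [Category.assoc, tensorQ₁_s', Category.assoc, hc]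
    exact e
  · rw [Category.assoc, tensorQ₁_β, reassoc_of% gT, sqMk_β, Category.assoc]

end

end Distributor

end InternalGpd

/-! ### The comprehensive factorization -/

theorem mainTheorem3 {E : Type u} [Category.{v} E] [BarrExact E] {A B C : IntGpd E}
    (S : Distributor A B) (T : Distributor B C) :
    ∃ Q : S.spanComp T ⟶ (S.tensor T).total,
      (Q.F₀ = S.tensorπ T ∧ Q ≫ (S.tensor T).leg = S.spanCompLeg T) ∧
      (∀ Q' : S.spanComp T ⟶ (S.tensor T).total,
        Q'.F₀ = S.tensorπ T → Q' ≫ (S.tensor T).leg = S.spanCompLeg T → Q' = Q) ∧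
      IsFull Q ∧ IsEssSurj Q ∧ IsFinal Q ∧ IsDiscreteFibration (S.tensor T).leg ∧
      ∀ (Z : IntGpd E) (F : S.spanComp T ⟶ Z) (G : Z ⟶ A.prod C),
        IsFinal F → IsDiscreteFibration G → F ≫ G = S.spanCompLeg T →
          ∃! i : Z ≅ (S.tensor T).total, F ≫ i.hom = Q ∧ i.hom ≫ (S.tensor T).leg = G := by
  have hP : IsDiscreteFibration (S.tensor T).leg := (S.tensor T).isDiscreteFibration_leg
  have hQ : IsFull (S.tensorQ T) := S.isFull_tensorQ T
  have fac : S.tensorQ T ≫ (S.tensor T).leg = S.spanCompLeg T :=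
    IntFunctor.hom_ext (S.tensorπ_leg T) (S.tensorQ₁_leg T)
  refine ⟨S.tensorQ T, ⟨rfl, fac⟩, fun Q' h₀ h => IntFunctor.hom_ext h₀ ?_, hQ, hQ.isEssSurj,
    hQ.isFinal, hP, fun Z F G hF hG h =>
      hF.existsUnique_iso hG hQ.isFinal hP (h.trans fac.symm)⟩
  -- Uniqueness of Q₁: as `P` is a discrete fibration, the arrow component is determined by its
  -- composite with `P` and by its codomain, and the latter is fixed by the object component.
  refine hP.hom_ext (congrArg IntFunctor.F₁ (h.trans fac.symm)) ?_
  rw [Q'.map_c, h₀]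
  exact (S.tensorQ T).map_c.symm
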